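/- Let $\mathcal S_+^k\subseteq\mathbb R^{k\times k}$ be the cone of symmetric positive semidefinite $k\times k$ real matrices. A polytope $P\subseteq\mathbb R^N$ is said to admit a psd lift (spectrahedral lift) of size $k$ if there are an affine subspace $\mathcal L\subseteq\mathbb R^{k\times k}$ and a linear map $\pi:\mathbb R^{k\times k}\to\mathbb R^N$ with $P=\pi(\mathcal S_+^k\cap\mathcal L)$, and the psd rank $\mathrm{rk}_{\mathsf{psd}}(P)$ is the smallest $k$ such that $P$ admits a psd lift of size $k$. For $n\ge 1$ let \[ \mathrm{corr}_n=\mathrm{conv}\left(\{xx^T : x\in\{0,1\}^n\}\right)\subseteq\mathbb R^{n\times n} \] be the correlation polytope. **Theorem.** There is a constant $\alpha>0$ such that for every $n\ge 1$, \[ \mathrm{rk}_{\mathsf{psd}}(\mathrm{corr}_n)\ \ge\ 2^{\alpha n^{2/13}} . \] Equivalently, for every $n\ge 1$, $\mathrm{corr}_n$ admits no psd lift of size $k<2^{\alpha n^{2/13}}$. -/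

import Mathlib

/-- A subset `P` of a real vector space admits a positive semidefinite lift of size `k` if
`P = π (S₊ᵏ ∩ L)` for some affine subspace `L` of the space of real `k × k` matrices and some
linear map `π`, where `S₊ᵏ` is the cone of symmetric positive semidefinite `k × k` matrices. -/
def HasPsdLift {E : Type*} [AddCommGroup E] [Module ℝ E] (P : Set E) (k : ℕ) : Prop :=
  ∃ (L : AffineSubspace ℝ (Matrix (Fin k) (Fin k) ℝ)) (π : Matrix (Fin k) (Fin k) ℝ →ₗ[ℝ] E),
    P = π '' ({Y : Matrix (Fin k) (Fin k) ℝ | Y.PosSemidef} ∩ (L : Set (Matrix (Fin k) (Fin k) ℝ)))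

/-- The psd rank of `P`: the smallest size of a psd lift of `P`. (Every polytope has a psd lift;
the infimum is `0` by convention for a set without one.) -/
noncomputable def psdRank {E : Type*} [AddCommGroup E] [Module ℝ E] (P : Set E) : ℕ :=
  sInf {k : ℕ | HasPsdLift P k}

/-- The correlation polytope `conv {x xᵀ : x ∈ {0,1}ⁿ}` in the space of real `n × n` matrices. -/
def corrPolytope (n : ℕ) : Set (Matrix (Fin n) (Fin n) ℝ) :=
  convexHull ℝ {M | ∃ x : Fin n → ℝ, (∀ i, x i = 0 ∨ x i = 1) ∧ M = Matrix.vecMulVec x x}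

/-! Put m = 2s+1. On {0,1}^m the quadratic (z - s)(z - s - 1) in the coordinate sum z is
nonnegative, yet low-degree sums of squares do not detect this. The signed weight D =
`knapsackWeight` acts on symmetric polynomials of low degree as if z were m/2. It is nonnegative on
squares of degree at most s (`sum_knapsackWeight_mul_sq_nonneg`) but gives the quadratic -1/4 of its
positive total mass.

Take m blocks of b variables. Each transversal S carries a copy of the quadratic, an affine
functional of xxᵀ that is nonnegative on the polytope. By conic duality
(`exists_posDef_trace_approx`) a lift of size k makes all these values approximately tr(U_x V_S) +
c_S with U_x, V_S psd and c_S ≥ 0, so tr(U_x V_S) averages against D_S to something clearly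
negative.

Normalize to ∑ V_S = 1 and let F_x be the sum of D_S(x) V_S over the S for which V_S has small
trace. Then 1 - F_x is psd since |D| ≤ 1, and tr(F_x U_x) is negative on average. The power method
(`sum_trace_mul_pow_lt`) trades the unknown U_x for R_x², where R_x = (1 - F_x)^q has entries of
degree at most qm. A Walsh character of that degree rarely meets a random transversal in more than s
points once b is large compared with qm. Hence on average over S the matrix R is nearly of degree s
on S, and positivity on squares contradicts the negativity (`false_of_normalized_factorization`).

The gap δ is of order s^(-3), q of order s/δ, b of order qm, so n = mb of order s^6 excludes sizes
up to 2^s. This gives the exponent 1/6, which exceeds 2/13. -/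

open Finset

/-! ### The knapsack pseudo-expectation: evaluation at half-integral cardinality. -/

section Knapsack

open Polynomial

/-- The alternating sign gives a top finite difference, and the denominator moves the evaluation
point to (2s+1)/2. That point is not an integer, so no denominator vanishes and each has absolute
value at least 1. -/
noncomputable def knapsackWeight (s w : ℕ) : ℝ := (-1) ^ (s + w) / ((2 * s + 1 : ℝ) - 2 * w)

theorem knapsackWeight_succ_succ (s w : ℕ) :
    knapsackWeight (s + 1) (w + 1) = knapsackWeight s w := by
  unfold knapsackWeight
  have h1 : ((-1 : ℝ)) ^ (s + 1 + (w + 1)) = (-1) ^ (s + w) := by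
    rw [show s + 1 + (w + 1) = s + w + 2 by ring, pow_add]; norm_num
  rw [h1]; push_cast; congr 1; ring

theorem one_le_abs_odd_sub_even (s w : ℕ) : (1 : ℝ) ≤ |(2 * s + 1 : ℝ) - 2 * w| := by
  have h : (1 : ℤ) ≤ |(2 * s + 1 : ℤ) - 2 * w| := Int.one_le_abs (by omega)
  exact_mod_cast h

theorem odd_sub_even_ne_zero (s w : ℕ) : (2 * s + 1 : ℝ) - 2 * w ≠ 0 := fun h => by
  have := one_le_abs_odd_sub_even s w
  rw [h] at this; norm_num at this

theorem abs_knapsackWeight_le_one (s w : ℕ) : |knapsackWeight s w| ≤ 1 := by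
  rw [knapsackWeight, abs_div, abs_pow, abs_neg, abs_one, one_pow]
  exact div_le_one_of_le₀ (one_le_abs_odd_sub_even s w) (abs_nonneg _)

noncomputable def knapsackMass (s : ℕ) : ℝ :=
  ∑ w ∈ range (2 * s + 2), ((2 * s + 1).choose w : ℝ) * knapsackWeight s w

theorem sum_choose_neg_one_pow_mul_eval_eq_zero {n : ℕ} {Q : ℝ[X]} (hQ : Q.natDegree < n) :
    ∑ w ∈ range (n + 1), (n.choose w : ℝ) * (-1) ^ w * Q.eval (w : ℝ) = 0 := by
  have h := congrFun (Polynomial.fwdDiff_iter_eq_zero_of_degree_lt hQ) 0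
  rw [fwdDiff_iter_eq_sum_shift] at h
  have h2 : ∑ w ∈ range (n + 1), (n.choose w : ℝ) * (-1) ^ w * Q.eval (w : ℝ) =
      (-1) ^ n * ∑ k ∈ range (n + 1), ((-1 : ℤ) ^ (n - k) * n.choose k) • Q.eval (0 + k • (1:ℝ)) := by
    rw [mul_sum]
    refine sum_congr rfl fun w hw => ?_
    have hw' : w ≤ n := by simpa [Nat.lt_succ_iff] using hw
    have h3 : (-1 : ℝ) ^ n * (-1) ^ (n - w) = (-1) ^ w := by
      obtain ⟨d, rfl⟩ := Nat.exists_eq_add_of_le hw'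
      rw [Nat.add_sub_cancel_left, pow_add, mul_assoc, ← pow_add, ← two_mul, pow_mul]; norm_num
    rw [← h3]
    simp only [zsmul_eq_mul, nsmul_eq_mul, mul_one, zero_add]
    push_cast; ring
  rw [h2, h]; simp

/-- Write P = P(a) + (X - a)Q with a = (2s+1)/2. The factor w - a cancels the denominator of the
weight, leaving an alternating binomial sum of Q, which vanishes because deg Q < 2s+1. -/
theorem sum_choose_mul_knapsackWeight_mul_eval (s : ℕ) {P : ℝ[X]} (hP : P.natDegree ≤ 2 * s + 1) :
    ∑ w ∈ range (2 * s + 2), ((2 * s + 1).choose w : ℝ) * knapsackWeight s w * P.eval (w : ℝ) =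
      P.eval ((2 * s + 1 : ℝ) / 2) * knapsackMass s := by
  set a : ℝ := (2 * s + 1 : ℝ) / 2 with ha
  set Q := P /ₘ (X - C a) with hQ
  have hdeg : Q.natDegree < 2 * s + 1 := by
    rw [hQ, natDegree_divByMonic _ (monic_X_sub_C a), natDegree_X_sub_C]; omega
  have hev : ∀ w : ℝ, P.eval w = P.eval a + (w - a) * Q.eval w := fun w => by
    conv_lhs => rw [← modByMonic_add_div P (X - C a), modByMonic_X_sub_C_eq_C_eval]
    simp [hQ]
  have hz := sum_choose_neg_one_pow_mul_eval_eq_zero hdeg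
  have key : ∀ w ∈ range (2 * s + 2),
      ((2 * s + 1).choose w : ℝ) * knapsackWeight s w * P.eval (w : ℝ) =
      P.eval a * (((2 * s + 1).choose w : ℝ) * knapsackWeight s w) +
       (-(-1) ^ s / 2) * (((2 * s + 1).choose w : ℝ) * (-1) ^ w * Q.eval (w : ℝ)) := fun w _ => by
    rw [hev w, knapsackWeight, ha]
    have := odd_sub_even_ne_zero s w
    field_simp
    ring
  rw [sum_congr rfl key, sum_add_distrib, ← mul_sum, ← mul_sum, hz, mul_zero, add_zero]
  rfl

theorem knapsackMass_zero : knapsackMass 0 = 2 := by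
  simp [knapsackMass, knapsackWeight, sum_range_succ]; norm_num

theorem knapsackMass_succ (s : ℕ) :
    knapsackMass (s + 1) = 4 * (2 * s + 2) / (2 * s + 3) * knapsackMass s := by
  -- This test polynomial kills the terms w = 0 and w = 2s+3, and its product with the binomial
  -- coefficient is a multiple of the binomial coefficient of 2s+1. One evaluation therefore gives
  -- the recursion.
  have h := sum_choose_mul_knapsackWeight_mul_eval (s + 1) (P := X * (C (2 * s + 3 : ℝ) - X)) (by
    refine (natDegree_mul_le).trans ?_
    have : (C (2 * s + 3 : ℝ) - X).natDegree ≤ 1 := by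
      refine (natDegree_sub_le _ _).trans (by simp only [natDegree_C, natDegree_X]; omega)
    simp only [natDegree_X]; omega)
  have h1 : ∑ w ∈ range (2 * (s + 1) + 2), ((2 * (s + 1) + 1).choose w : ℝ) *
      knapsackWeight (s + 1) w * (X * (C (2 * s + 3 : ℝ) - X)).eval (w : ℝ) =
      (2 * s + 3) * (2 * s + 2) * knapsackMass s := by
    rw [show 2 * (s + 1) + 2 = 2 * s + 2 + 1 + 1 by ring, sum_range_succ, sum_range_succ', knapsackMass,
      mul_sum]
    simp only [eval_mul, eval_X, eval_sub, eval_C]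
    push_cast
    simp only [sub_self, mul_zero, zero_mul, add_zero]
    refine sum_congr rfl fun w hw => ?_
    rw [knapsackWeight_succ_succ]
    have hw' : w < 2 * s + 2 := by simpa using hw
    have e1 := Nat.add_one_mul_choose_eq (2 * s + 2) w
    have e2 := Nat.choose_mul_succ_eq (2 * s + 1) w
    have e1' : (2 * (s:ℝ) + 3) * ((2 * s + 2).choose w : ℝ) = ((2 * s + 3).choose (w + 1)) * (w + 1) := by
      exact_mod_cast e1
    have e2' : ((2 * s + 1).choose w : ℝ) * (2 * s + 2) = ((2 * s + 2).choose w) * (2 * s + 2 - w) := by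
      have h0 : ((2 * s + 1 + 1 - w : ℕ) : ℝ) = 2 * s + 2 - w := by
        rw [Nat.cast_sub (by omega)]; push_cast; ring
      rw [← h0]; exact_mod_cast e2
    rw [show 2 * (s + 1) + 1 = 2 * s + 3 by ring]
    linear_combination (-(knapsackWeight s w) * (2 * s + 2 - w)) * e1' - (knapsackWeight s w) * (2 * s + 3) * e2'
  rw [h1] at h
  simp only [eval_mul, eval_X, eval_sub, eval_C] at h
  push_cast at h
  have h3 : (2 * (s:ℝ) + 3) ≠ 0 := by positivity
  field_simp
  have : (2 * (s:ℝ) + 3) * (knapsackMass (s + 1) * (2 * s + 3) - 4 * (2 * s + 2) * knapsackMass s) = 0 := by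
    linear_combination (-4) * h
  rcases mul_eq_zero.1 this with h4 | h4
  · exact absurd h4 h3
  · linarith

theorem two_pow_div_le_knapsackMass (s : ℕ) : (2 : ℝ) ^ (2 * s + 1) / (s + 1) ≤ knapsackMass s := by
  induction s with
  | zero => rw [knapsackMass_zero]; norm_num
  | succ s ih =>
    rw [knapsackMass_succ]
    refine le_trans ?_ (mul_le_mul_of_nonneg_left ih (by positivity))
    rw [show 2 * (s + 1) + 1 = 2 * s + 1 + 2 by ring, pow_add, div_mul_div_comm,
      div_le_div_iff₀ (by positivity) (by positivity)]
    push_cast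
    have : (0 : ℝ) < 2 ^ (2 * s + 1) := by positivity
    nlinarith [mul_nonneg this.le (Nat.cast_nonneg (α := ℝ) s)]

theorem knapsackMass_pos (s : ℕ) : 0 < knapsackMass s :=
  lt_of_lt_of_le (by positivity) (two_pow_div_le_knapsackMass s)

theorem sum_powerset_knapsackWeight_mul_eval {ι : Type*} {s : ℕ} {U : Finset ι} (hU : #U = 2 * s + 1) {P : ℝ[X]}
    (hP : P.natDegree ≤ 2 * s + 1) :
    ∑ x ∈ U.powerset, knapsackWeight s #x * P.eval (#x : ℝ) =
      P.eval ((2 * s + 1 : ℝ) / 2) * knapsackMass s := by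
  rw [← sum_choose_mul_knapsackWeight_mul_eval s hP,
    Finset.sum_powerset_apply_card (fun w => knapsackWeight s w * P.eval (w : ℝ)), hU]
  simp [mul_assoc]

theorem sum_powerset_insert_insert {ι M : Type*} [DecidableEq ι] [AddCommMonoid M] {i j : ι}
    {W : Finset ι} (hi : i ∉ W) (hj : j ∉ W) (hij : i ≠ j) (F : Finset ι → M) :
    ∑ x ∈ (insert i (insert j W)).powerset, F x =
      ∑ y ∈ W.powerset, (F y + F (insert j y) + (F (insert i y) + F (insert i (insert j y)))) := by
  have hi' : i ∉ insert j W := by simp [hij, hi]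
  rw [sum_powerset_insert hi', sum_powerset_insert hj, sum_powerset_insert hj]
  simp only [sum_add_distrib]

/-! ### Nonnegativity of the pseudo-expectation on low-degree squares. -/

section Positivity

variable {ι : Type*} [DecidableEq ι]

theorem map_swap_of_notMem {i j : ι} {A : Finset ι} (hi : i ∉ A) (hj : j ∉ A) :
    A.map (Equiv.swap i j).toEmbedding = A := by
  ext k
  simp only [mem_map_equiv, Equiv.symm_swap]
  rcases eq_or_ne k i with rfl | hki
  · simp [hi, hj]
  rcases eq_or_ne k j with rfl | hkj
  · simp [hi, hj]
  rw [Equiv.swap_apply_of_ne_of_ne hki hkj]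

/-- A function antisymmetric under swapping i and j vanishes where the two coordinates agree. Where
they differ, exactly one element is used up, and the weight for s+1 becomes the weight for s. This
drives the induction on s. -/
theorem sum_knapsackWeight_mul_sq_of_swap {s : ℕ} {U : Finset ι} {i j : ι} (hi : i ∈ U)
    (hj : j ∈ U) (hij : i ≠ j) (v : Finset ι → ℝ) :
    ∑ x ∈ U.powerset, knapsackWeight (s + 1) #x *
      (∑ A ∈ x.powerset, (v A - v (A.map (Equiv.swap i j).toEmbedding))) ^ 2 =
    2 * ∑ y ∈ ((U.erase i).erase j).powerset, knapsackWeight s #y *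
      (∑ A ∈ y.powerset, (v (insert i A) - v (insert j A))) ^ 2 := by
  set W := (U.erase i).erase j with hW
  have hiW : i ∉ W := by simp [hW]
  have hjW : j ∉ W := by simp [hW]
  have hU : U = insert i (insert j W) := by
    rw [hW, insert_erase (mem_erase.2 ⟨hij.symm, hj⟩), insert_erase hi]
  rw [hU, sum_powerset_insert_insert hiW hjW hij, mul_sum]
  refine sum_congr rfl fun y hy => ?_
  have hyW : y ⊆ W := mem_powerset.1 hy
  have hiy : i ∉ y := fun h => hiW (hyW h)
  have hjy : j ∉ y := fun h => hjW (hyW h)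
  have h0 : ∀ A ∈ y.powerset, A.map (Equiv.swap i j).toEmbedding = A := fun A hA =>
    map_swap_of_notMem (fun h => hiy (mem_powerset.1 hA h)) (fun h => hjy (mem_powerset.1 hA h))
  have g0 : ∑ A ∈ y.powerset, (v A - v (A.map (Equiv.swap i j).toEmbedding)) = 0 :=
    sum_eq_zero fun A hA => by rw [h0 A hA, sub_self]
  have gi : ∑ A ∈ y.powerset, (v (insert i A) - v ((insert i A).map (Equiv.swap i j).toEmbedding)) =
      ∑ A ∈ y.powerset, (v (insert i A) - v (insert j A)) :=
    sum_congr rfl fun A hA => by rw [map_insert, h0 A hA]; simp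
  have gj : ∑ A ∈ y.powerset, (v (insert j A) - v ((insert j A).map (Equiv.swap i j).toEmbedding)) =
      -∑ A ∈ y.powerset, (v (insert i A) - v (insert j A)) := by
    rw [← sum_neg_distrib]
    exact sum_congr rfl fun A hA => by rw [map_insert, h0 A hA]; simp
  have gij : ∑ A ∈ y.powerset, (v (insert i (insert j A)) -
      v ((insert i (insert j A)).map (Equiv.swap i j).toEmbedding)) = 0 :=
    sum_eq_zero fun A hA => by
      rw [map_insert, map_insert, h0 A hA]; simp [Finset.insert_comm j i]
  rw [sum_powerset_insert_insert hiy hjy hij, sum_powerset_insert hiy, sum_powerset_insert hjy]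
  simp only [sum_add_distrib]
  rw [g0, gi, gj, gij, card_insert_of_notMem hiy, card_insert_of_notMem hjy,
    knapsackWeight_succ_succ]
  ring

theorem eq_of_card_eq_of_swap_invariant {U : Finset ι} {v : Finset ι → ℝ}
    (hv : ∀ i ∈ U, ∀ j ∈ U, ∀ A, v (A.map (Equiv.swap i j).toEmbedding) = v A)
    {A B : Finset ι} (hA : A ⊆ U) (hB : B ⊆ U) (h : #A = #B) : v A = v B := by
  induction hn : #(A \ B) generalizing A with
  | zero =>
    have : A ⊆ B := by simpa [sdiff_eq_empty_iff_subset] using hn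
    rw [eq_of_subset_of_card_le this h.ge]
  | succ n ih =>
    obtain ⟨i, hi⟩ : (A \ B).Nonempty := card_pos.1 (by omega)
    obtain ⟨j, hj⟩ : (B \ A).Nonempty := card_pos.1 (by
      have := card_sdiff_add_card_inter A B
      have := card_sdiff_add_card_inter B A
      rw [inter_comm] at this
      omega)
    rw [mem_sdiff] at hi hj
    have hij : i ≠ j := by rintro rfl; exact hj.2 hi.1
    have hmap : A.map (Equiv.swap i j).toEmbedding = insert j (A.erase i) := by
      conv_lhs => rw [← insert_erase hi.1]
      rw [map_insert, map_swap_of_notMem (by simp) (by simp [hj.2])]; simp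
    rw [← hv i (hA hi.1) j (hB hj.1) A]
    refine ih ?_ ?_ ?_
    · rw [hmap, insert_subset_iff]
      exact ⟨hB hj.1, (erase_subset _ _).trans hA⟩
    · rw [card_map, h]
    · have : insert j (A.erase i) \ B = (A \ B).erase i := by
        rw [insert_sdiff_of_mem _ hj.1]
        ext k; simp only [mem_sdiff, mem_erase]; tauto
      rw [hmap, this, card_erase_of_mem (mem_sdiff.2 hi), hn]; rfl

/-- With γ j the common value of v on j-element sets, the sum over subsets of x is ∑ γ j (|x| choose
j), a polynomial in |x|. -/
theorem exists_polynomial_eval_card {ι : Type*} {U : Finset ι} {v : Finset ι → ℝ} {r : ℕ}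
    (hv : ∀ A ⊆ U, ∀ B ⊆ U, #A = #B → v A = v B) (hr : ∀ A, r < #A → v A = 0) :
    ∃ p : ℝ[X], p.natDegree ≤ r ∧ ∀ x ⊆ U, ∑ A ∈ x.powerset, v A = p.eval (#x : ℝ) := by
  classical
  set γ : ℕ → ℝ := fun j => if h : ∃ A ⊆ U, #A = j then v h.choose else 0 with hγ
  have hvγ : ∀ A ⊆ U, v A = γ #A := fun A hA => by
    have h : ∃ B ⊆ U, #B = #A := ⟨A, hA, rfl⟩
    rw [hγ]; simp only [dif_pos h]
    exact hv A hA _ h.choose_spec.1 h.choose_spec.2.symm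
  have hγ0 : ∀ j, r < j → γ j = 0 := fun j hj => by
    rw [hγ]; dsimp only
    split_ifs with h
    · exact hr _ (by rw [h.choose_spec.2]; exact hj)
    · rfl
  refine ⟨∑ j ∈ range (r + 1), C (γ j / j.factorial) * descPochhammer ℝ j, ?_, fun x hx => ?_⟩
  · refine natDegree_sum_le_of_forall_le _ _ fun j hj => ?_
    refine (natDegree_C_mul_le _ _).trans ?_
    rw [descPochhammer_natDegree]
    simpa [Nat.lt_succ_iff] using hj
  · have h1 : ∑ A ∈ x.powerset, v A = ∑ A ∈ x.powerset, γ #A :=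
      sum_congr rfl fun A hA => hvγ A ((mem_powerset.1 hA).trans hx)
    rw [h1, Finset.sum_powerset_apply_card, eval_finsetSum]
    have h2 : ∀ j, (eval (#x : ℝ) (C (γ j / j.factorial) * descPochhammer ℝ j)) =
        (#x).choose j • γ j := fun j => by
      rw [eval_mul, eval_C, descPochhammer_eval_eq_descFactorial, Nat.descFactorial_eq_factorial_mul_choose]
      have : (j.factorial : ℝ) ≠ 0 := by positivity
      push_cast
      field_simp
      rw [nsmul_eq_mul]; ring
    simp only [h2]
    have e1 := sum_subset (range_mono (show #x + 1 ≤ max #x r + 1 by omega))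
      (f := fun j => (#x).choose j • γ j) (fun j _ hj => by
        have : #x < j := by simpa using hj
        simp [Nat.choose_eq_zero_of_lt this])
    have e2 := sum_subset (range_mono (show r + 1 ≤ max #x r + 1 by omega))
      (f := fun j => (#x).choose j • γ j) (fun j _ hj => by
        have : r < j := by simpa using hj
        simp [hγ0 j this])
    rw [e1, e2]
theorem map_swap_map_swap (i j : ι) (A : Finset ι) :
    (A.map (Equiv.swap i j).toEmbedding).map (Equiv.swap i j).toEmbedding = A := by
  ext k; simp

/-- Rows and columns indexed by sets larger than r are zero, so an eigenvector with nonzero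
eigenvalue is automatically a polynomial of degree at most r. -/
noncomputable def momentMatrix [Fintype ι] (s r : ℕ) (U : Finset ι) :
    Matrix (Finset ι) (Finset ι) ℝ :=
  Matrix.of fun A B => ∑ x ∈ U.powerset, knapsackWeight s #x *
    ((if A ⊆ x ∧ #A ≤ r then 1 else 0) * (if B ⊆ x ∧ #B ≤ r then 1 else 0))

theorem momentMatrix_isHermitian [Fintype ι] (s r : ℕ) (U : Finset ι) :
    (momentMatrix s r U).IsHermitian := by
  ext A B
  simp only [momentMatrix, Matrix.conjTranspose_apply, Matrix.of_apply, star_trivial]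
  exact sum_congr rfl fun x _ => by ring

theorem momentMatrix_map_swap [Fintype ι] (s r : ℕ) {U : Finset ι} {i j : ι} (hi : i ∈ U)
    (hj : j ∈ U) (A B : Finset ι) :
    momentMatrix s r U (A.map (Equiv.swap i j).toEmbedding)
      (B.map (Equiv.swap i j).toEmbedding) = momentMatrix s r U A B := by
  have hU : U.map (Equiv.swap i j).toEmbedding = U := by
    ext k
    simp only [mem_map_equiv, Equiv.symm_swap]
    rcases eq_or_ne k i with rfl | hki
    · simp [hi, hj]
    rcases eq_or_ne k j with rfl | hkj
    · simp [hi, hj]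
    rw [Equiv.swap_apply_of_ne_of_ne hki hkj]
  have hm : ∀ x ∈ U.powerset, x.map (Equiv.swap i j).toEmbedding ∈ U.powerset := fun x hx => by
    rw [mem_powerset] at hx ⊢
    rw [← hU]; exact map_subset_map.2 hx
  simp only [momentMatrix, Matrix.of_apply]
  symm
  refine sum_nbij' (fun x => x.map (Equiv.swap i j).toEmbedding)
    (fun x => x.map (Equiv.swap i j).toEmbedding) hm hm
    (fun x _ => map_swap_map_swap i j x) (fun x _ => map_swap_map_swap i j x) fun x _ => ?_
  simp only [map_subset_map, card_map]

theorem momentMatrix_mulVec_apply_of_lt [Fintype ι] {s r : ℕ} {U A : Finset ι} (hA : r < #A)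
    (v : Finset ι → ℝ) : (momentMatrix s r U).mulVec v A = 0 := by
  simp [momentMatrix, Matrix.mulVec, dotProduct, not_le.2 hA]

theorem dotProduct_momentMatrix_mulVec [Fintype ι] {s r : ℕ} {U : Finset ι} {v : Finset ι → ℝ}
    (hv : ∀ A, r < #A → v A = 0) :
    v ⬝ᵥ (momentMatrix s r U).mulVec v =
      ∑ x ∈ U.powerset, knapsackWeight s #x * (∑ A ∈ x.powerset, v A) ^ 2 := by
  have h : ∀ x : Finset ι, ∑ A ∈ x.powerset, v A =
      ∑ A, v A * (if A ⊆ x ∧ #A ≤ r then 1 else 0) := fun x => by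
    simp only [mul_ite, mul_one, mul_zero]
    rw [← sum_filter]
    refine sum_subset_zero_on_sdiff ?_ ?_ (fun _ _ => rfl) |>.symm
    · intro A; simp +contextual
    · intro A hA
      simp only [mem_sdiff, mem_powerset, mem_filter, mem_univ, true_and, not_and, not_le] at hA
      exact hv A (hA.2 hA.1)
  simp only [h, dotProduct, Matrix.mulVec, momentMatrix, Matrix.of_apply, mul_sum, sum_mul, sq]
  rw [sum_congr rfl fun A _ => sum_comm, sum_comm]
  refine sum_congr rfl fun x _ => ?_
  rw [sum_comm]
  refine sum_congr rfl fun A _ => sum_congr rfl fun B _ => ?_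
  ring

/-- The functional `q ↦ ∑ x, D x * q x` is nonnegative on squares of polynomials of degree `≤ s`. -/
theorem sum_knapsackWeight_mul_sq_nonneg [Fintype ι] {s r : ℕ} (hrs : r ≤ s) {U : Finset ι}
    (hU : #U = 2 * s + 1) {c : Finset ι → ℝ} (hc : ∀ A, r < #A → c A = 0) :
    0 ≤ ∑ x ∈ U.powerset, knapsackWeight s #x * (∑ A ∈ x.powerset, c A) ^ 2 := by
  -- For symmetric v the square is p(|x|)² with 2 deg p ≤ 2s, so the sum is p((2s+1)/2)² times the
  -- positive mass.
  have symm_case : ∀ (s r : ℕ) (U : Finset ι) (v : Finset ι → ℝ), r ≤ s → #U = 2 * s + 1 →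
      (∀ A, r < #A → v A = 0) → (∀ A ⊆ U, ∀ B ⊆ U, #A = #B → v A = v B) →
      0 ≤ ∑ x ∈ U.powerset, knapsackWeight s #x * (∑ A ∈ x.powerset, v A) ^ 2 := by
    intro s r U v hrs hU hv hv2
    obtain ⟨p, hp, hpe⟩ := exists_polynomial_eval_card hv2 hv
    have h1 : ∑ x ∈ U.powerset, knapsackWeight s #x * (∑ A ∈ x.powerset, v A) ^ 2 =
        ∑ x ∈ U.powerset, knapsackWeight s #x * (p ^ 2).eval (#x : ℝ) :=
      sum_congr rfl fun x hx => by rw [hpe x (mem_powerset.1 hx), eval_pow]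
    rw [h1, sum_powerset_knapsackWeight_mul_eval hU (natDegree_pow_le.trans (by omega)), eval_pow]
    exact mul_nonneg (sq_nonneg _) (knapsackMass_pos s).le
  induction s generalizing r U c with
  | zero =>
    refine symm_case 0 r U c hrs hU hc fun A _ B _ hAB => ?_
    rcases Nat.eq_zero_or_pos #A with h | h
    · rw [card_eq_zero.1 h, card_eq_zero.1 (hAB.symm.trans h)]
    · rw [hc A (by omega), hc B (by omega)]
  | succ s ih =>
    have hH := momentMatrix_isHermitian (s + 1) r U
    suffices hpos : (momentMatrix (s + 1) r U).PosSemidef by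
      rw [← dotProduct_momentMatrix_mulVec hc]
      simpa using hpos.dotProduct_mulVec_nonneg c
    rw [hH.posSemidef_iff_eigenvalues_nonneg]
    intro k
    by_contra hneg
    -- A negative eigenvalue is impossible: the antisymmetrization e of its eigenvector v under any
    -- swap has the same eigenvalue or is zero, and induction makes its form nonnegative, so e = 0.
    -- Hence v is symmetric, and the symmetric case applies.
    set μ := hH.eigenvalues k
    replace hneg : μ < 0 := not_le.1 hneg
    set v : Finset ι → ℝ := ⇑(hH.eigenvectorBasis k) with hvdef
    have hMv : (momentMatrix (s + 1) r U).mulVec v = μ • v := hH.mulVec_eigenvectorBasis k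
    have hvv : v ⬝ᵥ v ≠ 0 := fun h0 => by
      have h1 : v = 0 := by simpa [dotProduct_self_eq_zero] using h0
      exact hH.eigenvectorBasis.toBasis.ne_zero k (by
        ext A; simpa using congrFun h1 A)
    have hvpos : 0 < v ⬝ᵥ v := lt_of_le_of_ne (by
      simpa [dotProduct] using sum_nonneg fun i (_ : i ∈ univ) => mul_self_nonneg (v i)) (Ne.symm hvv)
    have supp : ∀ w : Finset ι → ℝ, (momentMatrix (s + 1) r U).mulVec w = μ • w →
        ∀ A, r < #A → w A = 0 := fun w hw A hA => by
      have := congrFun hw A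
      rw [momentMatrix_mulVec_apply_of_lt hA] at this
      simpa [hneg.ne] using this.symm
    have hQ : ∀ w : Finset ι → ℝ, (momentMatrix (s + 1) r U).mulVec w = μ • w →
        ∑ x ∈ U.powerset, knapsackWeight (s + 1) #x * (∑ A ∈ x.powerset, w A) ^ 2 =
          μ * (w ⬝ᵥ w) := fun w hw => by
      rw [← dotProduct_momentMatrix_mulVec (supp w hw), hw, dotProduct_smul, smul_eq_mul]
    have hinv : ∀ i ∈ U, ∀ j ∈ U, ∀ A, v (A.map (Equiv.swap i j).toEmbedding) = v A := by
      intro i hi j hj A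
      rcases eq_or_ne i j with rfl | hij
      · simp
      set e : Finset ι → ℝ := fun A => v A - v (A.map (Equiv.swap i j).toEmbedding) with he
      have hMe : (momentMatrix (s + 1) r U).mulVec e = μ • e := by
        have h2 : (momentMatrix (s + 1) r U).mulVec
            (fun A => v (A.map (Equiv.swap i j).toEmbedding)) =
            fun A => μ * v (A.map (Equiv.swap i j).toEmbedding) := by
          funext B
          have h3 := congrFun hMv (B.map (Equiv.swap i j).toEmbedding)
          rw [Pi.smul_apply, smul_eq_mul] at h3
          rw [← h3]
          simp only [Matrix.mulVec, dotProduct]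
          refine sum_nbij' (fun x => x.map (Equiv.swap i j).toEmbedding)
            (fun x => x.map (Equiv.swap i j).toEmbedding) (by simp) (by simp)
            (fun x _ => map_swap_map_swap i j x) (fun x _ => map_swap_map_swap i j x) fun x _ => ?_
          rw [momentMatrix_map_swap _ _ hi hj]
        have h4 : e = v - fun A => v (A.map (Equiv.swap i j).toEmbedding) := rfl
        rw [h4, Matrix.mulVec_sub, hMv, h2]
        funext B; simp [mul_sub]
      have hnn : 0 ≤ μ * (e ⬝ᵥ e) := by
        rw [← hQ e hMe, he, sum_knapsackWeight_mul_sq_of_swap hi hj hij]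
        refine mul_nonneg zero_le_two ?_
        have hcard : #((U.erase i).erase j) = 2 * s + 1 := by
          rw [card_erase_of_mem (mem_erase.2 ⟨hij.symm, hj⟩), card_erase_of_mem hi, hU]; omega
        -- Zeroing d on sets containing i or j is harmless for the sums over y, and it lowers the
        -- degree to r - 1, since inserting then really enlarges A.
        set d : Finset ι → ℝ := fun A =>
          if i ∈ A ∨ j ∈ A then 0 else v (insert i A) - v (insert j A) with hd
        have hsum : ∀ y ∈ ((U.erase i).erase j).powerset,
            ∑ A ∈ y.powerset, (v (insert i A) - v (insert j A)) = ∑ A ∈ y.powerset, d A := by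
          intro y hy
          refine sum_congr rfl fun A hA => ?_
          have hAW := (mem_powerset.1 hA).trans (mem_powerset.1 hy)
          have h5 : i ∉ A := fun h => by simpa using hAW h
          have h6 : j ∉ A := fun h => by simpa using hAW h
          simp [hd, h5, h6]
        rw [sum_congr rfl fun y hy => by rw [hsum y hy]]
        refine ih (r := r - 1) (by omega) hcard fun A hA => ?_
        rw [hd]; dsimp only
        split_ifs with h7
        · rfl
        · push Not at h7
          rw [supp v hMv, supp v hMv, sub_zero]
          · rw [card_insert_of_notMem h7.2]; omega
          · rw [card_insert_of_notMem h7.1]; omega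
      have hee : 0 ≤ e ⬝ᵥ e := by
        simpa [dotProduct] using sum_nonneg fun i (_ : i ∈ univ) => mul_self_nonneg (e i)
      have he0 : e ⬝ᵥ e = 0 := by nlinarith
      have : e = 0 := by simpa [dotProduct_self_eq_zero] using he0
      have := congrFun this A
      simp only [he, Pi.zero_apply] at this
      linarith
    have h8 := symm_case (s + 1) r U v hrs hU (supp v hMv) fun A hA B hB hAB =>
      eq_of_card_eq_of_swap_invariant hinv hA hB hAB
    rw [hQ v hMv] at h8
    nlinarith

end Positivity

theorem sum_powerset_knapsackWeight {ι : Type*} {s : ℕ} {U : Finset ι} (hU : #U = 2 * s + 1) :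
    ∑ x ∈ U.powerset, knapsackWeight s #x = knapsackMass s := by
  simpa using sum_powerset_knapsackWeight_mul_eval hU (P := 1) (by simp)

theorem sum_powerset_knapsackWeight_mul_quadratic {ι : Type*} {s : ℕ} (hs : 1 ≤ s) {U : Finset ι}
    (hU : #U = 2 * s + 1) :
    ∑ x ∈ U.powerset, knapsackWeight s #x * (((#x : ℝ) - s) * (#x - (s + 1))) =
      -(knapsackMass s / 4) := by
  have h := sum_powerset_knapsackWeight_mul_eval hU
    (P := (X - C (s : ℝ)) * (X - C (s + 1 : ℝ))) (by
      refine natDegree_mul_le.trans ?_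
      rw [natDegree_X_sub_C, natDegree_X_sub_C]; omega)
  simp only [eval_mul, eval_sub, eval_X, eval_C] at h
  rw [h]; ring

end Knapsack

/-! ### Walsh analysis on the cube and low-degree functions. -/

section Fourier

variable {ι : Type*} [DecidableEq ι]

/-- The Walsh character of the cube, whose points are the subsets of `ι`. -/
def walsh (A x : Finset ι) : ℝ := ∏ i ∈ x, if i ∈ A then -1 else 1

theorem walsh_eq_neg_one_pow (A x : Finset ι) : walsh A x = (-1) ^ #(A ∩ x) := by
  rw [walsh, prod_ite, prod_const, prod_const_one, mul_one, filter_mem_eq_inter, inter_comm]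

theorem walsh_comm (A x : Finset ι) : walsh A x = walsh x A := by
  rw [walsh_eq_neg_one_pow, walsh_eq_neg_one_pow, inter_comm]

theorem walsh_mul_walsh (A B x : Finset ι) : walsh A x * walsh B x = walsh (symmDiff A B) x := by
  rw [walsh, walsh, walsh, ← prod_mul_distrib]
  refine prod_congr rfl fun i _ => ?_
  by_cases hA : i ∈ A <;> by_cases hB : i ∈ B <;> simp [mem_symmDiff, hA, hB]

theorem walsh_union (A : Finset ι) {y z : Finset ι} (h : Disjoint y z) :
    walsh A (y ∪ z) = walsh A y * walsh A z := prod_union h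

theorem walsh_eq_sum_powerset (A y : Finset ι) :
    walsh A y = ∑ B ∈ y.powerset, ∏ i ∈ B, if i ∈ A then (-2 : ℝ) else 0 := by
  rw [← prod_one_add, walsh]
  refine prod_congr rfl fun i _ => ?_
  split_ifs <;> norm_num

variable [Fintype ι]

theorem sum_walsh (A : Finset ι) :
    ∑ x, walsh A x = if A = ∅ then (2 : ℝ) ^ Fintype.card ι else 0 := by
  have h : ∑ x, walsh A x = ∏ i : ι, (1 + if i ∈ A then (-1 : ℝ) else 1) := by
    rw [prod_one_add, powerset_univ]; rfl
  rw [h]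
  split_ifs with hA
  · subst hA; norm_num
  · obtain ⟨i, hi⟩ := nonempty_iff_ne_empty.2 hA
    exact prod_eq_zero (mem_univ i) (by simp [hi])

theorem sum_walsh_mul_walsh (A B : Finset ι) :
    ∑ x, walsh A x * walsh B x = if A = B then (2 : ℝ) ^ Fintype.card ι else 0 := by
  simp only [walsh_mul_walsh, sum_walsh, ← Finset.bot_eq_empty, symmDiff_eq_bot]

theorem sum_sq_sum_mul_walsh (s : Finset (Finset ι)) (c : Finset ι → ℝ) :
    ∑ x, (∑ A ∈ s, c A * walsh A x) ^ 2 = 2 ^ Fintype.card ι * ∑ A ∈ s, c A ^ 2 := by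
  have h : ∀ x : Finset ι, (∑ A ∈ s, c A * walsh A x) ^ 2 =
      ∑ A ∈ s, ∑ B ∈ s, c A * c B * (walsh A x * walsh B x) := fun x => by
    rw [sq, sum_mul_sum]
    exact sum_congr rfl fun A _ => sum_congr rfl fun B _ => by ring
  simp only [h]
  rw [sum_comm, mul_sum]
  refine sum_congr rfl fun A hA => ?_
  rw [sum_comm]
  simp only [← mul_sum, sum_walsh_mul_walsh, mul_ite, mul_zero, sum_ite_eq, hA, if_true]
  ring

noncomputable def walshCoeff (a : Finset ι → ℝ) (A : Finset ι) : ℝ :=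
  (∑ x, a x * walsh A x) / 2 ^ Fintype.card ι

theorem sum_walshCoeff_mul_walsh (a : Finset ι → ℝ) (x : Finset ι) :
    ∑ A, walshCoeff a A * walsh A x = a x := by
  have h : ∀ A, walshCoeff a A * walsh A x =
      ∑ y, a y / 2 ^ Fintype.card ι * (walsh y A * walsh x A) := fun A => by
    rw [walshCoeff, sum_div, sum_mul]
    refine sum_congr rfl fun y _ => ?_
    rw [walsh_comm A y, walsh_comm A x]; ring
  simp only [h]
  rw [sum_comm]
  simp [← mul_sum, sum_walsh_mul_walsh]

theorem sum_sq_eq_sum_walshCoeff_sq (a : Finset ι → ℝ) :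
    ∑ x, a x ^ 2 = 2 ^ Fintype.card ι * ∑ A, walshCoeff a A ^ 2 := by
  rw [← sum_sq_sum_mul_walsh]
  simp only [sum_walshCoeff_mul_walsh]

/-- Functions on the cube of degree at most `l`. -/
def degreeLE (ι : Type*) [DecidableEq ι] (l : ℕ) : Submodule ℝ (Finset ι → ℝ) :=
  Submodule.span ℝ {f | ∃ A : Finset ι, #A ≤ l ∧ walsh A = f}

omit [Fintype ι] in
theorem mul_mem_degreeLE {l l' : ℕ} {a a' : Finset ι → ℝ} (ha : a ∈ degreeLE ι l)
    (ha' : a' ∈ degreeLE ι l') : a * a' ∈ degreeLE ι (l + l') := by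
  have h := Submodule.mul_mem_mul ha ha'
  rw [degreeLE, degreeLE, Submodule.span_mul_span] at h
  refine Submodule.span_mono ?_ h
  rintro _ ⟨_, ⟨A, hA, rfl⟩, _, ⟨B, hB, rfl⟩, rfl⟩
  refine ⟨symmDiff A B, ?_, funext fun x => (walsh_mul_walsh A B x).symm⟩
  refine (card_le_card (symmDiff_le_sup (a := A) (b := B))).trans ?_
  exact (card_union_le _ _).trans (add_le_add hA hB)

omit [Fintype ι] in
theorem const_mem_degreeLE (l : ℕ) (c : ℝ) : (fun _ => c) ∈ degreeLE ι l := by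
  have h : (fun _ => c : Finset ι → ℝ) = c • walsh ∅ := by
    funext x; simp [walsh]
  rw [h]
  exact Submodule.smul_mem _ _ (Submodule.subset_span ⟨∅, by simp, rfl⟩)

theorem walshCoeff_eq_zero_of_mem_degreeLE {l : ℕ} {a : Finset ι → ℝ} (ha : a ∈ degreeLE ι l)
    {A : Finset ι} (hA : l < #A) : walshCoeff a A = 0 := by
  induction ha using Submodule.span_induction with
  | mem f hf =>
    obtain ⟨B, hB, rfl⟩ := hf
    have : B ≠ A := by rintro rfl; omega
    simp [walshCoeff, sum_walsh_mul_walsh, this]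
  | zero => simp [walshCoeff]
  | add f g _ _ hf hg =>
    have : walshCoeff (f + g) A = walshCoeff f A + walshCoeff g A := by
      simp [walshCoeff, add_mul, sum_add_distrib, add_div]
    rw [this, hf, hg, add_zero]
  | smul c f _ hf =>
    have : walshCoeff (c • f) A = c * walshCoeff f A := by
      simp [walshCoeff, mul_assoc, ← mul_sum, mul_div_assoc]
    rw [this, hf, mul_zero]

/-- If A contains a coordinate outside T, flipping it preserves the function and negates the
character, so the Walsh coefficient at A is zero. -/
theorem junta_mem_degreeLE (T : Finset ι) (F : Finset ι → ℝ) :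
    (fun x => F (x ∩ T)) ∈ degreeLE ι #T := by
  set a : Finset ι → ℝ := fun x => F (x ∩ T) with ha
  have h0 : ∀ A, ¬ A ⊆ T → walshCoeff a A = 0 := fun A hA => by
    obtain ⟨i, hiA, hiT⟩ := not_subset.1 hA
    have h1 : ∑ x, a x * walsh A x = 0 := by
      rw [← powerset_univ, ← insert_erase (mem_univ i), sum_powerset_insert (notMem_erase i _),
        ← sum_add_distrib]
      refine sum_eq_zero fun y hy => ?_
      have hiy : i ∉ y := fun h => by simpa using mem_powerset.1 hy h
      have h2 : walsh A (insert i y) = -walsh A y := by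
        rw [walsh, prod_insert hiy, if_pos hiA, walsh]; ring
      have h3 : a (insert i y) = a y := by
        rw [ha]; dsimp only; rw [insert_inter_of_notMem hiT]
      rw [h2, h3]; ring
    rw [walshCoeff, h1, zero_div]
  have h4 : a = ∑ A, walshCoeff a A • walsh A := by
    funext x; rw [Finset.sum_apply, ← sum_walshCoeff_mul_walsh a x]; rfl
  rw [h4]
  refine Submodule.sum_mem _ fun A _ => ?_
  by_cases hA : A ⊆ T
  · exact Submodule.smul_mem _ _ (Submodule.subset_span ⟨A, card_le_card hA, rfl⟩)
  · rw [h0 A hA, zero_smul]; exact Submodule.zero_mem _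

/-- The part of `a` of degree greater than `r` in the coordinates in `T`. -/
noncomputable def highPart (T : Finset ι) (r : ℕ) (a : Finset ι → ℝ) (x : Finset ι) : ℝ :=
  ∑ A with r < #(A ∩ T), walshCoeff a A * walsh A x

theorem highPart_sum_mul {κ : Type*} (s : Finset κ) (T : Finset ι) (r : ℕ) (c : κ → ℝ)
    (a : κ → Finset ι → ℝ) (x : Finset ι) :
    highPart T r (fun x => ∑ p ∈ s, c p * a p x) x = ∑ p ∈ s, c p * highPart T r (a p) x := by
  have h : ∀ A, walshCoeff (fun x => ∑ p ∈ s, c p * a p x) A = ∑ p ∈ s, c p * walshCoeff (a p) A :=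
    fun A => by
      simp only [walshCoeff, sum_mul, mul_div_assoc']
      rw [sum_comm, sum_div]
      simp only [mul_sum, mul_assoc]
  simp only [highPart, h, sum_mul, mul_sum]
  rw [sum_comm]
  simp only [mul_assoc]

theorem sum_highPart_sq (T : Finset ι) (r : ℕ) (a : Finset ι → ℝ) :
    ∑ x, highPart T r a x ^ 2 =
      2 ^ Fintype.card ι * ∑ A with r < #(A ∩ T), walshCoeff a A ^ 2 :=
  sum_sq_sum_mul_walsh _ _

theorem sum_eq_sum_powerset_compl (T : Finset ι) (Φ : Finset ι → ℝ) :
    ∑ x, Φ x = ∑ z ∈ Tᶜ.powerset, ∑ y ∈ T.powerset, Φ (y ∪ z) := by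
  rw [← sum_product']
  refine sum_nbij' (fun x => (x \ T, x ∩ T)) (fun p => p.2 ∪ p.1) ?_ ?_ ?_ ?_ ?_
  · intro x _
    simp only [mem_product, mem_powerset]
    exact ⟨fun i hi => mem_compl.2 (mem_sdiff.1 hi).2, inter_subset_right⟩
  · simp
  · intro x _; ext i; simp only [mem_union, mem_inter, mem_sdiff]; tauto
  · rintro ⟨z, y⟩ h
    simp only [mem_product, mem_powerset] at h
    have h1 : ∀ i ∈ z, i ∉ T := fun i hi => mem_compl.1 (h.1 hi)
    have h2 : ∀ i ∈ y, i ∈ T := fun i hi => h.2 hi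
    ext i <;> simp only [mem_union, mem_inter, mem_sdiff]
    · have := h1 i; have := h2 i; tauto
    · have := h1 i; have := h2 i; tauto
  · intro x _
    congr 1
    ext i; simp only [mem_union, mem_inter, mem_sdiff]; tauto

/-- Once the coordinates outside T are fixed, expanding characters by ∏ (1 - 2xᵢ) leaves a
polynomial of degree at most s on T. -/
theorem sum_knapsackWeight_mul_lowPart_sq_nonneg {s : ℕ} {T : Finset ι} (hT : #T = 2 * s + 1)
    (c : Finset ι → ℝ) :
    0 ≤ ∑ x, knapsackWeight s #(x ∩ T) * (∑ A with #(A ∩ T) ≤ s, c A * walsh A x) ^ 2 := by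
  rw [sum_eq_sum_powerset_compl T]
  refine sum_nonneg fun z hz => ?_
  have hzT : Disjoint T z := by
    rw [disjoint_left]; intro i hi h; exact mem_compl.1 (mem_powerset.1 hz h) hi
  set d : Finset ι → ℝ := fun B => if B ⊆ T then
    ∑ A with #(A ∩ T) ≤ s, c A * walsh A z * ∏ i ∈ B, (if i ∈ A then (-2 : ℝ) else 0) else 0 with hd
  have hd0 : ∀ B, s < #B → d B = 0 := fun B hB => by
    rw [hd]; dsimp only
    split_ifs with hBT
    · refine sum_eq_zero fun A hA => ?_
      have hAs : #(A ∩ T) ≤ s := by simpa using hA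
      have : ¬ B ⊆ A := fun h => by
        have := card_le_card (subset_inter h hBT); omega
      obtain ⟨i, hi, hiA⟩ := not_subset.1 this
      rw [prod_eq_zero hi (by simp [hiA]), mul_zero]
    · rfl
  refine le_of_le_of_eq (sum_knapsackWeight_mul_sq_nonneg le_rfl hT hd0) ?_
  refine sum_congr rfl fun y hy => ?_
  have hyT := mem_powerset.1 hy
  have h1 : (y ∪ z) ∩ T = y := by
    rw [union_inter_distrib_right, inter_eq_left.2 hyT, inter_comm z,
      disjoint_iff_inter_eq_empty.1 hzT, union_empty]
  rw [h1]
  congr 2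
  have h2 : ∀ B ∈ y.powerset, d B = ∑ A with #(A ∩ T) ≤ s,
      c A * walsh A z * ∏ i ∈ B, (if i ∈ A then (-2 : ℝ) else 0) := fun B hB => by
    rw [hd]; dsimp only; rw [if_pos ((mem_powerset.1 hB).trans hyT)]
  rw [sum_congr rfl h2, sum_comm]
  refine sum_congr rfl fun A _ => ?_
  rw [walsh_union _ (hzT.mono_left hyT), ← mul_sum, ← walsh_eq_sum_powerset]; ring

/-- Split a into low and high parts. The low square contributes nonnegatively, and since the weight
is at most 1 in absolute value, the cross term is absorbed by the weighted AM-GM inequality with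
parameter θ. -/
theorem neg_le_sum_knapsackWeight_mul_sq {s : ℕ} {T : Finset ι} (hT : #T = 2 * s + 1)
    (a : Finset ι → ℝ) {θ : ℝ} (hθ : 0 < θ) :
    -(θ * ∑ x, a x ^ 2 + (1 + 1 / θ) * ∑ x, highPart T s a x ^ 2) ≤
      ∑ x, knapsackWeight s #(x ∩ T) * a x ^ 2 := by
  have h0 := sum_knapsackWeight_mul_lowPart_sq_nonneg hT (walshCoeff a)
  set low : Finset ι → ℝ := fun x => ∑ A with #(A ∩ T) ≤ s, walshCoeff a A * walsh A x with hlow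
  have h1 : ∀ x, a x = low x + highPart T s a x := fun x => by
    rw [← sum_walshCoeff_mul_walsh a x, ← sum_filter_add_sum_filter_not univ (fun A => #(A ∩ T) ≤ s)]
    simp only [not_le]; rfl
  have h2 : ∀ x, knapsackWeight s #(x ∩ T) * low x ^ 2 -
      (θ * a x ^ 2 + (1 + 1 / θ) * highPart T s a x ^ 2) ≤ knapsackWeight s #(x ∩ T) * a x ^ 2 := by
    intro x
    set w := knapsackWeight s #(x ∩ T)
    set h := highPart T s a x
    have hw := abs_le.1 (abs_knapsackWeight_le_one s #(x ∩ T))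
    have e1 : low x = a x - h := by rw [h1 x]; ring
    rw [e1]
    have e2 : θ * (a x) ^ 2 + (1 / θ) * h ^ 2 = θ * (a x) ^ 2 + (h / θ) ^ 2 * θ := by
      field_simp
    have e3 : w * (a x - h) ^ 2 - w * a x ^ 2 = w * (h ^ 2 - 2 * (a x * h)) := by ring
    have e4 : |h ^ 2 - 2 * (a x * h)| ≤ θ * (a x) ^ 2 + (1 / θ) * h ^ 2 + h ^ 2 := by
      have p1 : 0 ≤ θ * (a x - h / θ) ^ 2 := by positivity
      have p2 : 0 ≤ θ * (a x + h / θ) ^ 2 := by positivity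
      have p3 : θ * (a x - h / θ) ^ 2 = θ * (a x) ^ 2 + (1 / θ) * h ^ 2 - 2 * (a x * h) := by
        field_simp; ring
      have p4 : θ * (a x + h / θ) ^ 2 = θ * (a x) ^ 2 + (1 / θ) * h ^ 2 + 2 * (a x * h) := by
        field_simp; ring
      rw [abs_le]; constructor <;> nlinarith [sq_nonneg h]
    have e5 : w * (h ^ 2 - 2 * (a x * h)) ≤ |h ^ 2 - 2 * (a x * h)| := by
      refine (le_abs_self _).trans ?_
      rw [abs_mul]
      exact mul_le_of_le_one_left (abs_nonneg _) (abs_knapsackWeight_le_one s _)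
    have e6 : (1 + 1 / θ) * h ^ 2 = h ^ 2 + (1 / θ) * h ^ 2 := by ring
    linarith
  have h3 := sum_le_sum fun x (_ : x ∈ univ) => h2 x
  rw [sum_sub_distrib, sum_add_distrib, ← mul_sum, ← mul_sum] at h3
  linarith

end Fourier

/-! ### Random transversals of a block system. -/

section Graph

variable {m b : ℕ}

/-- The graph of `S`, a transversal of the `m` blocks of size `b`. -/
def transversal (S : Fin m → Fin b) : Finset (Fin m × Fin b) :=
  univ.map ⟨fun i => (i, S i), fun _ _ h => (Prod.mk.inj h).1⟩

theorem card_transversal (S : Fin m → Fin b) : #(transversal S) = m := by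
  simp [transversal]

theorem pow_card_inter_transversal (θ : ℝ) (A : Finset (Fin m × Fin b)) (S : Fin m → Fin b) :
    θ ^ #(A ∩ transversal S) = ∏ i, if (i, S i) ∈ A then θ else 1 := by
  rw [prod_ite, prod_const, prod_const_one, mul_one]
  congr 1
  have : A ∩ transversal S = ({i | (i, S i) ∈ A} : Finset (Fin m)).map
      ⟨fun i => (i, S i), fun _ _ h => (Prod.mk.inj h).1⟩ := by
    ext ⟨i, j⟩
    simp only [transversal, mem_inter, mem_map, mem_univ, true_and, mem_filter]
    constructor
    · rintro ⟨h, k, hk⟩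
      obtain ⟨rfl, rfl⟩ := Prod.mk.inj hk
      exact ⟨k, h, rfl⟩
    · rintro ⟨k, h, hk⟩
      obtain ⟨rfl, rfl⟩ := Prod.mk.inj hk
      exact ⟨h, k, rfl⟩
  rw [this, card_map]

/-- The blocks are independent, so the sum factors. Each factor is at most b exp(θ|Aᵢ|/b), with Aᵢ
the part of A in block i, and the product is at most e·b^m. -/
theorem sum_pow_card_inter_transversal_le {θ : ℝ} (hθ : 0 ≤ θ) {A : Finset (Fin m × Fin b)}
    (hA : θ * #A ≤ b) :
    ∑ S : Fin m → Fin b, θ ^ #(A ∩ transversal S) ≤ 3 * (b : ℝ) ^ m := by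
  simp only [pow_card_inter_transversal]
  rw [← Fintype.prod_sum (fun (i : Fin m) (j : Fin b) => if (i, j) ∈ A then θ else 1)]
  have hcard : ∑ i : Fin m, ((#{j : Fin b | (i, j) ∈ A} : ℕ) : ℝ) = #A := by
    have : A = univ.filter (· ∈ A) := by simp
    conv_rhs => rw [this, card_filter, ← univ_product_univ, sum_product]
    push_cast
    refine sum_congr rfl fun i _ => ?_
    rw [card_filter]; push_cast; rfl
  rcases Nat.eq_zero_or_pos b with rfl | hb
  · rcases Nat.eq_zero_or_pos m with rfl | hm
    · simp
    · have : Nonempty (Fin m) := ⟨⟨0, hm⟩⟩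
      simp [hm.ne']
  have hb' : (0 : ℝ) < b := by exact_mod_cast hb
  have hle : ∀ i ∈ (univ : Finset (Fin m)), ∑ j : Fin b, (if (i, j) ∈ A then θ else 1) ≤
      b * Real.exp (θ * #{j : Fin b | (i, j) ∈ A} / b) := fun i _ => by
    have h1 : ∑ j : Fin b, (if (i, j) ∈ A then θ else 1) ≤ b + θ * #{j : Fin b | (i, j) ∈ A} := by
      have : ∀ j ∈ (univ : Finset (Fin b)), (if (i, j) ∈ A then θ else 1) ≤
          1 + θ * (if (i, j) ∈ A then 1 else 0) := fun j _ => by split_ifs <;> simp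
      refine (sum_le_sum this).trans_eq ?_
      rw [sum_add_distrib, ← mul_sum]
      simp
    refine h1.trans ?_
    have h2 := Real.add_one_le_exp (θ * #{j : Fin b | (i, j) ∈ A} / b)
    calc (b : ℝ) + θ * #{j : Fin b | (i, j) ∈ A}
        = b * (θ * #{j : Fin b | (i, j) ∈ A} / b + 1) := by field_simp; ring
      _ ≤ _ := mul_le_mul_of_nonneg_left h2 hb'.le
  refine (prod_le_prod (fun i _ => sum_nonneg fun j _ => by split_ifs <;> simp [hθ]) hle).trans ?_
  rw [prod_mul_distrib, ← Real.exp_sum, ← sum_div, ← mul_sum, hcard, mul_comm]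
  simp only [prod_const, card_univ, Fintype.card_fin]
  refine mul_le_mul_of_nonneg_right ?_ (by positivity)
  have h3 : Real.exp (θ * #A / b) ≤ Real.exp 1 :=
    Real.exp_le_exp.2 (div_le_one_of_le₀ hA hb'.le)
  linarith [Real.exp_one_lt_d9]

theorem card_lt_card_inter_transversal_le {θ : ℝ} (hθ : 1 ≤ θ) {A : Finset (Fin m × Fin b)}
    (hA : θ * #A ≤ b) (r : ℕ) :
    (#{S : Fin m → Fin b | r < #(A ∩ transversal S)} : ℝ) ≤ 3 * (b : ℝ) ^ m / θ ^ (r + 1) := by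
  rw [le_div_iff₀ (by positivity)]
  refine le_trans ?_ (sum_pow_card_inter_transversal_le (by linarith) hA)
  rw [← nsmul_eq_mul, ← sum_const]
  refine (sum_le_sum (g := fun S => θ ^ #(A ∩ transversal S)) fun S hS => ?_).trans
    (sum_le_sum_of_subset_of_nonneg (subset_univ _) fun S _ _ => by positivity)
  simp only [mem_filter, mem_univ, true_and] at hS
  exact pow_le_pow_right₀ hθ hS

/-- By Parseval, each character of size at most l is counted once for every transversal meeting it
in more than r points, and Markov's inequality bounds their number. -/
theorem sum_sum_highPart_sq_le {θ : ℝ} (hθ : 1 ≤ θ) {l : ℕ} (hl : θ * l ≤ b) (r : ℕ)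
    {a : Finset (Fin m × Fin b) → ℝ} (ha : a ∈ degreeLE (Fin m × Fin b) l) :
    ∑ S : Fin m → Fin b, ∑ x, highPart (transversal S) r a x ^ 2 ≤
      3 * (b : ℝ) ^ m / θ ^ (r + 1) * ∑ x, a x ^ 2 := by
  simp only [sum_highPart_sq, sum_filter]
  rw [← mul_sum, sum_comm, sum_sq_eq_sum_walshCoeff_sq, mul_left_comm]
  refine mul_le_mul_of_nonneg_left ?_ (by positivity)
  rw [mul_sum]
  refine sum_le_sum fun A _ => ?_
  by_cases hA : l < #A
  · simp [walshCoeff_eq_zero_of_mem_degreeLE ha hA]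
  · rw [← sum_filter, sum_const, nsmul_eq_mul]
    refine mul_le_mul_of_nonneg_right (card_lt_card_inter_transversal_le hθ ?_ r) (sq_nonneg _)
    refine le_trans (mul_le_mul_of_nonneg_left ?_ (by linarith)) hl
    exact_mod_cast not_lt.1 hA

end Graph

/-! ### Trace inequalities for psd matrices. -/

section PosSemidef

variable {n : Type*} [Fintype n] [DecidableEq n]

open scoped MatrixOrder in
theorem Matrix.PosSemidef.exists_eq_transpose_mul_self {A : Matrix n n ℝ} (hA : A.PosSemidef) :
    ∃ C : Matrix n n ℝ, A = C.transpose * C := by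
  obtain ⟨C, hC⟩ := CStarAlgebra.nonneg_iff_eq_star_mul_self.1 (Matrix.nonneg_iff_posSemidef.2 hA)
  exact ⟨C, by simpa [Matrix.star_eq_conjTranspose] using hC⟩

open scoped MatrixOrder in
open Polynomial in
theorem Matrix.PosSemidef.aeval {G : Matrix n n ℝ} (hG : G.PosSemidef) {p : ℝ[X]}
    (hp : ∀ t, 0 ≤ t → 0 ≤ p.eval t) : (Polynomial.aeval G p).PosSemidef := by
  rw [← Matrix.nonneg_iff_posSemidef, ← cfc_polynomial p G hG.1]
  exact cfc_nonneg fun t ht =>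
    hp t (spectrum_nonneg_of_nonneg (Matrix.nonneg_iff_posSemidef.2 hG) ht)

theorem Matrix.PosSemidef.trace_mul_nonneg {A B : Matrix n n ℝ} (hA : A.PosSemidef)
    (hB : B.PosSemidef) : 0 ≤ (A * B).trace := by
  obtain ⟨C, rfl⟩ := hA.exists_eq_transpose_mul_self
  have h := (hB.mul_mul_conjTranspose_same C).trace_nonneg
  rwa [Matrix.trace_mul_cycle, Matrix.conjTranspose_eq_transpose_of_trivial] at h

omit [DecidableEq n] in
theorem Matrix.trace_transpose_mul_self (C : Matrix n n ℝ) :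
    (C.transpose * C).trace = ∑ i, ∑ j, C i j ^ 2 := by
  rw [sum_comm]
  simp [Matrix.trace, Matrix.mul_apply, sq]

theorem Matrix.PosSemidef.smul_one_sub {A : Matrix n n ℝ} (hA : A.PosSemidef) {c : ℝ}
    (hc : A.trace ≤ c) : (c • (1 : Matrix n n ℝ) - A).PosSemidef := by
  rw [Matrix.posSemidef_iff_dotProduct_mulVec]
  refine ⟨Matrix.IsHermitian.sub (by simp [Matrix.IsHermitian]) hA.1, fun x => ?_⟩
  obtain ⟨C, rfl⟩ := hA.exists_eq_transpose_mul_self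
  rw [Matrix.sub_mulVec, dotProduct_sub, sub_nonneg, Matrix.smul_mulVec, Matrix.one_mulVec,
    dotProduct_smul, smul_eq_mul, star_trivial, ← Matrix.mulVec_mulVec, Matrix.dotProduct_mulVec,
    Matrix.vecMul_transpose]
  have h1 := C.trace_transpose_mul_self
  have h2 : C.mulVec x ⬝ᵥ C.mulVec x ≤ (∑ i, ∑ j, C i j ^ 2) * (x ⬝ᵥ x) := by
    rw [dotProduct, sum_mul]
    refine sum_le_sum fun i _ => ?_
    have := sum_mul_sq_le_sq_mul_sq univ (C i) x
    simpa [Matrix.mulVec, dotProduct, sq] using this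
  refine h2.trans (mul_le_mul_of_nonneg_right (h1 ▸ hc) ?_)
  exact sum_nonneg fun i _ => mul_self_nonneg _

end PosSemidef

/-! ### The power method: from an arbitrary witness to a polynomial one. -/

section PowerMethod

theorem sub_mul_pow_add_nonneg {a t : ℝ} (ha : 0 ≤ a) (ht : 0 ≤ t) (d : ℕ) :
    0 ≤ (t - a) * t ^ d + a ^ (d + 1) := by
  rcases le_total a t with h | h
  · have := mul_nonneg (sub_nonneg.2 h) (pow_nonneg ht d)
    positivity
  · have h1 : (a - t) * t ^ d ≤ a * a ^ d :=
      mul_le_mul (by linarith) (pow_le_pow_left₀ ht h d) (pow_nonneg ht d) ha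
    rw [pow_succ]; linarith

theorem mul_sub_le_sub_mul_pow {a g t : ℝ} (ha : a ≤ g) (ht : 0 ≤ t) (d : ℕ) (hg : 0 ≤ g) :
    g ^ d * (t - g) ≤ (t - a) * t ^ d := by
  have hgd := pow_nonneg hg d
  have htd := pow_nonneg ht d
  rcases le_total g t with h | h
  · have h1 := pow_le_pow_left₀ hg h d
    have := mul_le_mul h1 (show t - g ≤ t - a by linarith) (by linarith) htd
    linarith
  · have h1 := pow_le_pow_left₀ ht h d
    rcases le_total a t with h2 | h2
    · nlinarith [mul_nonneg hgd (sub_nonneg.2 h), mul_nonneg (sub_nonneg.2 h2) htd]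
    · have e1 : (a - t) * t ^ d ≤ (a - t) * g ^ d := mul_le_mul_of_nonneg_left h1 (by linarith)
      have e2 : (a - t) * g ^ d ≤ (g - t) * g ^ d := mul_le_mul_of_nonneg_right (by linarith) hgd
      linarith

variable {Ω n : Type*} [Fintype Ω] [Nonempty Ω] [Fintype n] [DecidableEq n]

open Polynomial in
/-- If a bounded `U` witnesses that `F` is negative on average, then so does a high power of
`1 - F`. -/
theorem sum_trace_mul_pow_lt {F U : Ω → Matrix n n ℝ} (hG : ∀ x, (1 - F x).PosSemidef)
    (hU : ∀ x, (U x).PosSemidef) {B δ : ℝ} (hB : 0 < B) (hδ : 0 < δ) (hUB : ∀ x, (U x).trace ≤ B)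
    (hFU : ∑ x, (F x * U x).trace ≤ -(Fintype.card Ω * (2 * B * δ))) {d : ℕ}
    (hd : Fintype.card n * (1 + δ) ^ (d + 1) < (1 + 3 / 2 * δ) ^ d * (δ / 2)) :
    ∑ x, (F x * (1 - F x) ^ d).trace < -(δ * ∑ x, ((1 - F x) ^ d).trace) := by
  set a : ℝ := 1 + δ with ha
  set g : ℝ := 1 + 3 / 2 * δ with hg
  -- With G = 1 - F x and q(t) = (t - a)t^d, the right side is tr q(G). Split the identity as U/B +
  -- (1 - U/B), both psd. On the first piece use q(t) ≥ g^d (t - g), on the second q(t) ≥ -a^(d+1).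
  -- Since g > a, the gain g^d beats the loss for large d.
  have key : ∀ x, g ^ d / B * (-(F x * U x).trace - 3 / 2 * δ * B) - Fintype.card n * a ^ (d + 1) ≤
      -(F x * (1 - F x) ^ d).trace - δ * ((1 - F x) ^ d).trace := by
    intro x
    obtain ⟨G, hGdef⟩ : ∃ G, G = 1 - F x := ⟨_, rfl⟩
    have hGx := hG x
    rw [← hGdef] at hGx ⊢
    have hF : F x = 1 - G := by rw [hGdef]; abel
    have p1 : (Polynomial.aeval G ((X - C a) * X ^ d + C (a ^ (d + 1)) : ℝ[X])).PosSemidef :=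
      hGx.aeval fun t ht => by
        simpa using sub_mul_pow_add_nonneg (by positivity : 0 ≤ a) ht d
    have p2 : (Polynomial.aeval G ((X - C a) * X ^ d - C (g ^ d) * (X - C g) : ℝ[X])).PosSemidef :=
      hGx.aeval fun t ht => by
        simpa using mul_sub_le_sub_mul_pow (by linarith : a ≤ g) ht d (by positivity)
    have q1 := ((hU x).smul_one_sub (hUB x)).trace_mul_nonneg p1
    have q2 := (hU x).trace_mul_nonneg p2
    simp only [map_add, map_sub, map_mul, aeval_X_pow, aeval_X, aeval_C,
      Algebra.algebraMap_eq_smul_one] at q1 q2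
    have f1 : (F x * U x).trace = (U x).trace - (U x * G).trace := by
      rw [hF, sub_mul, one_mul, Matrix.trace_sub, Matrix.trace_mul_comm G]
    have f2 : (F x * G ^ d).trace = (G ^ d).trace - (G * G ^ d).trace := by
      rw [hF, sub_mul, one_mul, Matrix.trace_sub]
    have e3 : ((G - a • (1 : Matrix n n ℝ)) * G ^ d).trace =
        -(F x * G ^ d).trace - δ * (G ^ d).trace := by
      rw [f2, sub_mul, Matrix.trace_sub, smul_mul_assoc, one_mul, Matrix.trace_smul, smul_eq_mul]
      linear_combination (-(G ^ d).trace) * ha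
    rw [← e3]
    generalize (G - a • (1 : Matrix n n ℝ)) * G ^ d = Y at q1 q2 ⊢
    have e1 : (U x * (Y - g ^ d • (1 : Matrix n n ℝ) * (G - g • (1 : Matrix n n ℝ)))).trace =
        (U x * Y).trace - g ^ d * (-(F x * U x).trace - 3 / 2 * δ * (U x).trace) := by
      rw [mul_sub, Matrix.trace_sub, smul_mul_assoc, one_mul, Matrix.mul_smul, Matrix.trace_smul,
        smul_eq_mul, mul_sub, Matrix.trace_sub, Matrix.mul_smul, mul_one, Matrix.trace_smul,
        smul_eq_mul, f1]
      linear_combination (g ^ d * (U x).trace) * hg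
    have e2 : ((B • (1 : Matrix n n ℝ) - U x) * (Y + a ^ (d + 1) • (1 : Matrix n n ℝ))).trace =
        B * (Y.trace + a ^ (d + 1) * Fintype.card n) -
        (U x * Y).trace - a ^ (d + 1) * (U x).trace := by
      rw [sub_mul, Matrix.trace_sub, smul_mul_assoc, one_mul, Matrix.trace_smul, Matrix.trace_add,
        Matrix.trace_smul, Matrix.trace_one, mul_add, Matrix.trace_add, Matrix.mul_smul, mul_one,
        Matrix.trace_smul]
      simp only [smul_eq_mul]
      ring
    rw [e1] at q2
    rw [e2] at q1
    have htr := (hU x).trace_nonneg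
    have h1 : 0 ≤ a ^ (d + 1) * (U x).trace := by positivity
    have h2 : 0 ≤ g ^ d * (3 / 2 * δ * (B - (U x).trace)) := by
      have := sub_nonneg.2 (hUB x); positivity
    rw [sub_le_iff_le_add, div_mul_eq_mul_div, div_le_iff₀ hB]
    linarith
  have hs := sum_le_sum fun x (_ : x ∈ univ) => key x
  simp only [sum_sub_distrib, ← mul_sum, sum_neg_distrib, sum_const, card_univ, nsmul_eq_mul] at hs
  have hN : (0 : ℝ) < Fintype.card Ω := by exact_mod_cast Fintype.card_pos
  have h3 : (Fintype.card Ω : ℝ) * (g ^ d * (δ / 2)) ≤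
      g ^ d / B * (-∑ x, (F x * U x).trace - Fintype.card Ω * (3 / 2 * δ * B)) := by
    have : (Fintype.card Ω : ℝ) * (g ^ d * (δ / 2)) =
        g ^ d / B * (Fintype.card Ω * (2 * B * δ) - Fintype.card Ω * (3 / 2 * δ * B)) := by
      field_simp; ring
    rw [this]
    refine mul_le_mul_of_nonneg_left (by linarith) (by positivity)
  have h4 := mul_lt_mul_of_pos_left hd hN
  linarith

end PowerMethod

/-! ### Matrix form of the positivity estimate. -/

section LowDegree

variable {ι n : Type*} [DecidableEq ι] [Fintype ι] [Fintype n] [DecidableEq n]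

/-- With V = LᵀL, the trace of V R² is the sum of squares of the entries of LR, so the scalar
estimate applies entrywise. Cauchy-Schwarz then bounds the high parts of LR by those of R at the
cost of tr V. -/
theorem neg_le_sum_knapsackWeight_mul_trace {s : ℕ} {T : Finset ι} (hT : #T = 2 * s + 1)
    {V : Matrix n n ℝ} (hV : V.PosSemidef) {R : Finset ι → Matrix n n ℝ}
    (hR : ∀ x, (R x).transpose = R x) {θ : ℝ} (hθ : 0 < θ) :
    -(θ * ∑ x, (V * (R x * R x)).trace + (1 + 1 / θ) *
        (V.trace * ∑ p, ∑ j, ∑ x, highPart T s (fun y => R y p j) x ^ 2)) ≤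
      ∑ x, knapsackWeight s #(x ∩ T) * (V * (R x * R x)).trace := by
  obtain ⟨L, rfl⟩ := hV.exists_eq_transpose_mul_self
  have h1 : ∀ x, (L.transpose * L * (R x * R x)).trace = ∑ i, ∑ j, (∑ p, L i p * R x p j) ^ 2 := by
    intro x
    have : (L.transpose * L * (R x * R x)).trace = ((L * R x) * (L * R x).transpose).trace := by
      rw [Matrix.transpose_mul, hR, Matrix.mul_assoc L.transpose, Matrix.trace_mul_comm]
      simp only [Matrix.mul_assoc]
    rw [this, Matrix.trace]
    refine sum_congr rfl fun i _ => ?_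
    rw [Matrix.diag_apply, Matrix.mul_apply]
    simp only [Matrix.transpose_apply, Matrix.mul_apply, sq]
  have h2 := L.trace_transpose_mul_self
  have h3 : ∑ i, ∑ j, ∑ x, highPart T s (fun y => ∑ p, L i p * R y p j) x ^ 2 ≤
      (∑ i, ∑ p, L i p ^ 2) * ∑ p, ∑ j, ∑ x, highPart T s (fun y => R y p j) x ^ 2 := by
    rw [sum_mul]
    refine sum_le_sum fun i _ => ?_
    rw [sum_comm (s := univ (α := n)) (t := univ (α := n))
      (f := fun p j => ∑ x, highPart T s (fun y => R y p j) x ^ 2), mul_sum]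
    refine sum_le_sum fun j _ => ?_
    rw [sum_comm, mul_sum]
    refine sum_le_sum fun x _ => ?_
    rw [highPart_sum_mul]
    exact sum_mul_sq_le_sq_mul_sq _ _ _
  have h4 := sum_le_sum fun i (_ : i ∈ (univ : Finset n)) => sum_le_sum fun j (_ : j ∈ (univ : Finset n)) =>
    neg_le_sum_knapsackWeight_mul_sq hT (fun y => ∑ p, L i p * R y p j) hθ
  have h5 : ∑ i, ∑ j, ∑ x, (∑ p, L i p * R x p j) ^ 2 =
      ∑ x, ∑ i, ∑ j, (∑ p, L i p * R x p j) ^ 2 :=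
    (sum_congr rfl fun i _ => sum_comm).trans sum_comm
  have h6 : ∑ i, ∑ j, ∑ x, knapsackWeight s #(x ∩ T) * (∑ p, L i p * R x p j) ^ 2 =
      ∑ x, knapsackWeight s #(x ∩ T) * ∑ i, ∑ j, (∑ p, L i p * R x p j) ^ 2 := by
    simp only [mul_sum]
    exact (sum_congr rfl fun i _ => sum_comm).trans sum_comm
  simp only [h1, h2]
  rw [← h6, ← h5]
  refine le_trans ?_ h4
  simp only [sum_neg_distrib, sum_add_distrib, ← mul_sum]
  have := mul_le_mul_of_nonneg_left h3 (by positivity : 0 ≤ 1 + 1 / θ)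
  linarith

end LowDegree

/-! ### Excluding normalized factorizations. -/

section Factorization

variable {n : Type*} [Fintype n] [DecidableEq n]

theorem matrix_pow_mem_degreeLE {ι : Type*} [DecidableEq ι] {l : ℕ} {G : Finset ι → Matrix n n ℝ}
    (hG : ∀ i j, (fun x => G x i j) ∈ degreeLE ι l) (q : ℕ) (i j : n) :
    (fun x => (G x ^ q) i j) ∈ degreeLE ι (q * l) := by
  induction q generalizing i j with
  | zero =>
    simp only [pow_zero]
    exact const_mem_degreeLE _ _
  | succ q ih =>
    have h : (fun x => (G x ^ (q + 1)) i j) =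
        ∑ p, (fun x => (G x ^ q) i p) * (fun x => G x p j) := by
      funext x
      simp [pow_succ, Matrix.mul_apply]
    rw [h, Nat.succ_mul]
    exact Submodule.sum_mem _ fun p _ => mul_mem_degreeLE (ih i p) (hG p j)

theorem le_two_mul_card_filter_of_sum_eq {σ : Type*} [Fintype σ] {t : σ → ℝ} (ht : ∀ S, 0 ≤ t S)
    {c : ℝ} (hc : 0 < c) (hsum : ∑ S, t S = c) :
    (Fintype.card σ : ℝ) ≤ 2 * #{S | t S * Fintype.card σ ≤ 2 * c} := by
  set M : ℝ := (Fintype.card σ : ℝ)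
  have hM : 0 ≤ M := Nat.cast_nonneg _
  have h1 := card_filter_add_card_filter_not (s := (univ : Finset σ)) (fun S => t S * M ≤ 2 * c)
  rw [card_univ] at h1
  have h1' : (#{S | t S * M ≤ 2 * c} : ℝ) + #{S | ¬ t S * M ≤ 2 * c} = M := by
    rw [← Nat.cast_add, h1]
  have h2 : (#{S | ¬ t S * M ≤ 2 * c} : ℝ) * (2 * c) ≤ c * M := by
    rw [← nsmul_eq_mul, ← sum_const, ← hsum, sum_mul]
    refine (sum_le_sum (g := fun S => t S * M) fun S hS => ?_).trans
      (sum_le_sum_of_subset_of_nonneg (subset_univ _) fun S _ _ => mul_nonneg (ht S) hM)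
    exact (not_le.1 (mem_filter.1 hS).2).le
  nlinarith

/-- The θ-terms add up to at most θ tr R² because ∑ V S = 1. The high-part terms are controlled by a
uniform bound on tr V S over `good`, followed by averaging over all transversals. -/
theorem neg_le_sum_sum_knapsackWeight_mul_trace {s b l : ℕ}
    {V : (Fin (2 * s + 1) → Fin b) → Matrix n n ℝ} (hV : ∀ S, (V S).PosSemidef)
    (hVsum : ∑ S, V S = 1) {good : Finset (Fin (2 * s + 1) → Fin b)} {c : ℝ} (hc : 0 ≤ c)
    (hgood : ∀ S ∈ good, (V S).trace ≤ c)
    {R : Finset (Fin (2 * s + 1) × Fin b) → Matrix n n ℝ} (hRt : ∀ x, (R x).transpose = R x)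
    (hRdeg : ∀ i j, (fun x => R x i j) ∈ degreeLE (Fin (2 * s + 1) × Fin b) l)
    {θ Θ : ℝ} (hθ : 0 < θ) (hΘ : 1 ≤ Θ) (hl : Θ * l ≤ b) :
    -(θ * ∑ x, (R x * R x).trace + (1 + 1 / θ) * (c * (3 * (b : ℝ) ^ (2 * s + 1) / Θ ^ (s + 1) *
        ∑ x, (R x * R x).trace))) ≤
      ∑ S ∈ good, ∑ x, knapsackWeight s #(x ∩ transversal S) * (V S * (R x * R x)).trace := by
  have hRR : ∀ x, (R x * R x).PosSemidef := fun x => by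
    have := Matrix.posSemidef_conjTranspose_mul_self (R x)
    rwa [Matrix.conjTranspose_eq_transpose_of_trivial, hRt] at this
  set P : ℝ := ∑ x, (R x * R x).trace with hP
  have hPeq : P = ∑ p, ∑ j, ∑ x, R x p j ^ 2 := by
    have h1 : ∀ x, (R x * R x).trace = ∑ p, ∑ j, R x p j ^ 2 := fun x => by
      rw [← Matrix.trace_transpose_mul_self, hRt]
    rw [hP, sum_congr rfl fun x _ => h1 x]
    exact ((sum_congr rfl fun i _ => sum_comm).trans sum_comm).symm
  set H : (Fin (2 * s + 1) → Fin b) → ℝ := fun S =>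
    ∑ p, ∑ j, ∑ x, highPart (transversal S) s (fun y => R y p j) x ^ 2 with hH
  have hH0 : ∀ S, 0 ≤ H S := fun S =>
    sum_nonneg fun p _ => sum_nonneg fun j _ => sum_nonneg fun x _ => sq_nonneg _
  have hHsum : ∑ S, H S ≤ 3 * (b : ℝ) ^ (2 * s + 1) / Θ ^ (s + 1) * P := by
    rw [hPeq, hH, sum_comm, mul_sum]
    refine sum_le_sum fun p _ => ?_
    rw [sum_comm, mul_sum]
    exact sum_le_sum fun j _ => sum_sum_highPart_sq_le hΘ hl s (hRdeg p j)
  have hlow : ∀ S ∈ good, -(θ * ∑ x, (V S * (R x * R x)).trace + (1 + 1 / θ) * (c * H S)) ≤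
      ∑ x, knapsackWeight s #(x ∩ transversal S) * (V S * (R x * R x)).trace := fun S hS => by
    refine le_trans ?_ (neg_le_sum_knapsackWeight_mul_trace (card_transversal S) (hV S) hRt hθ)
    have h2 := mul_le_mul_of_nonneg_right (hgood S hS) (hH0 S)
    have h3 := mul_le_mul_of_nonneg_left h2 (by positivity : 0 ≤ 1 + 1 / θ)
    linarith
  refine le_trans ?_ (sum_le_sum hlow)
  have h5 : ∑ S ∈ good, ∑ x, (V S * (R x * R x)).trace ≤ P := by
    have h6 : ∑ S, ∑ x, (V S * (R x * R x)).trace = P := by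
      rw [sum_comm, hP]
      refine sum_congr rfl fun x _ => ?_
      rw [← Matrix.trace_sum, ← sum_mul, hVsum, one_mul]
    rw [← h6]
    exact sum_le_sum_of_subset_of_nonneg (subset_univ _) fun S _ _ => sum_nonneg fun x _ =>
      (hV S).trace_mul_nonneg (hRR x)
  have h7 : ∑ S ∈ good, H S ≤ 3 * (b : ℝ) ^ (2 * s + 1) / Θ ^ (s + 1) * P :=
    (sum_le_sum_of_subset_of_nonneg (subset_univ _) fun S _ _ => hH0 S).trans hHsum
  rw [sum_neg_distrib, sum_add_distrib, ← mul_sum, ← mul_sum, ← mul_sum]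
  have h9 := mul_le_mul_of_nonneg_left (mul_le_mul_of_nonneg_left h7 hc)
    (by positivity : 0 ≤ 1 + 1 / θ)
  have h10 := mul_le_mul_of_nonneg_left h5 hθ.le
  linarith

theorem false_of_normalized_factorization {s b q : ℕ} (hb : 1 ≤ b)
    {U : Finset (Fin (2 * s + 1) × Fin b) → Matrix n n ℝ}
    {V : (Fin (2 * s + 1) → Fin b) → Matrix n n ℝ}
    (hU : ∀ x, (U x).PosSemidef) (hV : ∀ S, (V S).PosSemidef) (hVsum : ∑ S, V S = 1)
    {B δ : ℝ} (hB : 0 < B) (hδ : 0 < δ) (hδ1 : δ ≤ 1) (hUB : ∀ x, (U x).trace ≤ B)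
    (hUV : ∀ S, Fintype.card (Fin (2 * s + 1) → Fin b) *
      ∑ x, knapsackWeight s #(x ∩ transversal S) * (U x * V S).trace ≤
        -(Fintype.card (Finset (Fin (2 * s + 1) × Fin b)) * (4 * B * δ)))
    (hq : Fintype.card n * (1 + δ) ^ (2 * q + 1) < (1 + 3 / 2 * δ) ^ (2 * q) * (δ / 2))
    {Θ : ℝ} (hΘ : 1 ≤ Θ) (hqb : Θ * (q * (2 * s + 1) : ℕ) ≤ b)
    (hk : 36 * Fintype.card n ≤ δ ^ 2 * Θ ^ (s + 1)) : False := by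
  have hbF : Nonempty (Fin b) := ⟨⟨0, hb⟩⟩
  set M : ℝ := (Fintype.card (Fin (2 * s + 1) → Fin b) : ℝ) with hMdef
  set N : ℝ := (Fintype.card (Finset (Fin (2 * s + 1) × Fin b)) : ℝ) with hNdef
  set k : ℝ := (Fintype.card n : ℝ) with hkdef
  have hM : 0 < M := by rw [hMdef]; exact_mod_cast Fintype.card_pos
  have hN : 0 < N := by rw [hNdef]; exact_mod_cast Fintype.card_pos
  have hMb : M = (b : ℝ) ^ (2 * s + 1) := by simp [hMdef]
  have htrsum : ∑ S, (V S).trace = k := by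
    rw [← Matrix.trace_sum, hVsum, Matrix.trace_one]
  have hk0 : 0 < k := by
    rw [hkdef]
    rcases isEmpty_or_nonempty n with h | h
    · exfalso
      have := hUV fun _ => ⟨0, hb⟩
      simp only [Matrix.trace, univ_eq_empty, sum_empty, mul_zero, sum_const_zero] at this
      have : 0 < N * (4 * B * δ) := by positivity
      linarith
    · exact_mod_cast Fintype.card_pos
  -- The traces sum to k, so by Markov at least half of the transversals are kept. Only half of the
  -- negativity is lost, which turns 4Bδ into 2Bδ.
  set good : Finset (Fin (2 * s + 1) → Fin b) := {S | (V S).trace * M ≤ 2 * k} with hgood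
  have hgoodcard : M ≤ 2 * #good :=
    le_two_mul_card_filter_of_sum_eq (fun S => (hV S).trace_nonneg) hk0 htrsum
  set F : Finset (Fin (2 * s + 1) × Fin b) → Matrix n n ℝ :=
    fun x => ∑ S ∈ good, knapsackWeight s #(x ∩ transversal S) • V S with hF
  have hG : ∀ x, (1 - F x).PosSemidef := fun x => by
    have h : 1 - F x = ∑ S, (if S ∈ good then 1 - knapsackWeight s #(x ∩ transversal S) else 1) • V S := by
      rw [hF, ← hVsum]
      dsimp only
      rw [← sum_filter_add_sum_filter_not univ (· ∈ good)
        (fun S => (if S ∈ good then 1 - knapsackWeight s #(x ∩ transversal S) else 1) • V S),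
        ← sum_filter_add_sum_filter_not univ (· ∈ good) V]
      have e1 : ∀ S ∈ univ.filter (· ∈ good),
          (if S ∈ good then 1 - knapsackWeight s #(x ∩ transversal S) else 1) • V S =
          V S - knapsackWeight s #(x ∩ transversal S) • V S := fun S hS => by
        rw [if_pos (mem_filter.1 hS).2, sub_smul, one_smul]
      have e2 : ∀ S ∈ univ.filter (¬ · ∈ good),
          (if S ∈ good then 1 - knapsackWeight s #(x ∩ transversal S) else 1) • V S = V S :=
        fun S hS => by rw [if_neg (mem_filter.1 hS).2, one_smul]
      rw [sum_congr rfl e1, sum_congr rfl e2, sum_sub_distrib]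
      have e3 : univ.filter (· ∈ good) = good := by simp
      rw [e3]; abel
    rw [h]
    refine Matrix.posSemidef_sum _ fun S _ => (hV S).smul ?_
    split_ifs
    · linarith [(abs_le.1 (abs_knapsackWeight_le_one s #(x ∩ transversal S))).2]
    · exact zero_le_one
  have htrF : ∀ (x) (Y : Matrix n n ℝ), (F x * Y).trace =
      ∑ S ∈ good, knapsackWeight s #(x ∩ transversal S) * (V S * Y).trace := fun x Y => by
    rw [hF]; dsimp only
    rw [sum_mul, Matrix.trace_sum]
    simp only [smul_mul_assoc, Matrix.trace_smul, smul_eq_mul]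
  have hFU : ∑ x, (F x * U x).trace ≤ -(N * (2 * B * δ)) := by
    simp only [htrF]
    rw [sum_comm]
    have h1 : ∀ S ∈ good, ∑ x, knapsackWeight s #(x ∩ transversal S) * (V S * U x).trace ≤
        -(N * (4 * B * δ)) / M := fun S _ => by
      rw [le_div_iff₀ hM, mul_comm _ M]
      simp only [Matrix.trace_mul_comm (V S)]
      exact hUV S
    refine (sum_le_sum h1).trans ?_
    rw [sum_const, nsmul_eq_mul, mul_div_assoc', div_le_iff₀ hM]
    have : 0 < N * (2 * B * δ) := by positivity
    nlinarith
  have hup := sum_trace_mul_pow_lt hG hU hB hδ hUB hFU hq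
  -- The even exponent 2q makes the new witness a square R², as the low-degree estimate requires.
  set R : Finset (Fin (2 * s + 1) × Fin b) → Matrix n n ℝ := fun x => (1 - F x) ^ q with hR
  have hRR : ∀ x, (1 - F x) ^ (2 * q) = R x * R x := fun x => by rw [two_mul, pow_add]
  have hRt : ∀ x, (R x).transpose = R x := fun x => by
    have := (hG x).1
    rw [Matrix.IsHermitian, Matrix.conjTranspose_eq_transpose_of_trivial] at this
    rw [hR]; dsimp only
    rw [Matrix.transpose_pow, this]
  simp only [hRR, htrF] at hup
  rw [sum_comm] at hup
  have hGdeg : ∀ i j, (fun x => (1 - F x) i j) ∈ degreeLE (Fin (2 * s + 1) × Fin b) (2 * s + 1) := by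
    intro i j
    have h : (fun x => (1 - F x) i j) = (fun _ => (1 : Matrix n n ℝ) i j) -
        ∑ S ∈ good, V S i j • (fun x => knapsackWeight s #(x ∩ transversal S)) := by
      funext x
      simp [hF, Matrix.sum_apply, mul_comm]
    rw [h]
    refine Submodule.sub_mem _ (const_mem_degreeLE _ _) (Submodule.sum_mem _ fun S _ =>
      Submodule.smul_mem _ _ ?_)
    have := junta_mem_degreeLE (transversal S) (fun y => knapsackWeight s #y)
    rwa [card_transversal] at this
  have hgoodtr : ∀ S ∈ good, (V S).trace ≤ 2 * k / M := fun S hS => by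
    rw [le_div_iff₀ hM]; exact (mem_filter.1 hS).2
  have hlow := neg_le_sum_sum_knapsackWeight_mul_trace hV hVsum (good := good)
    (by positivity) hgoodtr hRt (matrix_pow_mem_degreeLE hGdeg q) (half_pos hδ) hΘ hqb
  set P : ℝ := ∑ x, (R x * R x).trace
  have hP0 : 0 ≤ P := sum_nonneg fun x _ => by
    rw [← hRR]
    exact ((hG x).pow _).trace_nonneg
  have h8 : (1 + 1 / (δ / 2)) * (2 * k / M * (3 * (b : ℝ) ^ (2 * s + 1) / Θ ^ (s + 1) * P)) ≤
      δ / 2 * P := by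
    have e1 : (1 + 1 / (δ / 2)) * (2 * k / M * (3 * (b : ℝ) ^ (2 * s + 1) / Θ ^ (s + 1) * P)) =
        (δ + 2) * (6 * k) / (δ * Θ ^ (s + 1)) * P := by rw [← hMb]; field_simp; ring
    rw [e1]
    refine mul_le_mul_of_nonneg_right ?_ hP0
    rw [div_le_iff₀ (by positivity)]
    nlinarith
  linarith

end Factorization

/-! ### Rescaling a factorization, and the choice of parameters. -/

section Normalization

variable {n : Type*} [Fintype n] [DecidableEq n]

/-- Factor ∑ V S = CᵀC and take D = C⁻¹. Definiteness of the V S is what makes C invertible. -/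
theorem exists_normalization {σ : Type*} [Fintype σ] [Nonempty σ] {V : σ → Matrix n n ℝ}
    (hV : ∀ S, (V S).PosDef) :
    ∃ C D : Matrix n n ℝ, D * C = 1 ∧ ∑ S, D.transpose * V S * D = 1 := by
  have hW : (∑ S, V S).PosDef := Matrix.posDef_sum univ_nonempty fun S _ => hV S
  obtain ⟨C, hC⟩ := hW.posSemidef.exists_eq_transpose_mul_self
  have hdet : IsUnit C.det := by
    have := (Matrix.isUnit_iff_isUnit_det _).1 hW.isUnit
    rw [hC, Matrix.det_mul] at this
    exact isUnit_of_mul_isUnit_right this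
  refine ⟨C, C⁻¹, Matrix.nonsing_inv_mul _ hdet, ?_⟩
  have h1 : (C⁻¹).transpose * C.transpose = 1 := by
    rw [← Matrix.transpose_mul, Matrix.mul_nonsing_inv _ hdet, Matrix.transpose_one]
  rw [← sum_mul, ← mul_sum, hC, ← mul_assoc, h1, one_mul, Matrix.mul_nonsing_inv _ hdet]

theorem trace_conj_mul_conj {C D : Matrix n n ℝ} (h : D * C = 1) (U V : Matrix n n ℝ) :
    (C * U * C.transpose * (D.transpose * V * D)).trace = (U * V).trace := by
  have h1 : C.transpose * D.transpose = 1 := by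
    rw [← Matrix.transpose_mul, h, Matrix.transpose_one]
  rw [Matrix.trace_mul_comm, show D.transpose * V * D * (C * U * C.transpose) =
    D.transpose * (V * (D * C) * U * C.transpose) by simp only [mul_assoc], h, mul_one,
    Matrix.trace_mul_comm, mul_assoc, h1, mul_one, Matrix.trace_mul_comm]

end Normalization

theorem sum_inter_eq {ι : Type*} [Fintype ι] [DecidableEq ι] (T : Finset ι) (Φ : Finset ι → ℝ) :
    ∑ x, Φ (x ∩ T) = 2 ^ #Tᶜ * ∑ y ∈ T.powerset, Φ y := by
  rw [sum_eq_sum_powerset_compl T]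
  have h : ∀ z ∈ Tᶜ.powerset, ∑ y ∈ T.powerset, Φ ((y ∪ z) ∩ T) = ∑ y ∈ T.powerset, Φ y := by
    intro z hz
    refine sum_congr rfl fun y hy => ?_
    have hzT : T ∩ z = ∅ := by
      ext i; simp only [mem_inter, notMem_empty, iff_false, not_and]
      exact fun hi h => mem_compl.1 (mem_powerset.1 hz h) hi
    rw [union_inter_distrib_right, inter_eq_left.2 (mem_powerset.1 hy), inter_comm z, hzT,
      union_empty]
  rw [sum_congr rfl h, sum_const, card_powerset, nsmul_eq_mul]
  push_cast; rfl

theorem card_finset_eq {ι : Type*} [Fintype ι] [DecidableEq ι] (T : Finset ι) :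
    (Fintype.card (Finset ι) : ℝ) = 2 ^ #Tᶜ * 2 ^ #T := by
  rw [Fintype.card_finset, ← pow_add, card_compl, Nat.sub_add_cancel (card_le_univ T)]
  push_cast; rfl

/-- The exponent in the power method. -/
def powerExponent (s : ℕ) : ℕ := 64 * (s + 1) * (2 * s + 1) ^ 2 * (4 * s + 10)

/-- The block size for which `2 ^ s`-dimensional factorizations are excluded. -/
def blockSize (s : ℕ) : ℕ := 2 ^ 22 * (powerExponent s * (2 * s + 1))

theorem succ_le_two_pow (s : ℕ) : (s + 1 : ℝ) ≤ 2 ^ s := by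
  exact_mod_cast Nat.lt_two_pow_self (n := s)

theorem powerExponent_spec {s k : ℕ} (hk : k ≤ 2 ^ s) {δ : ℝ}
    (hδ : δ = 1 / (32 * (s + 1) * (2 * s + 1) ^ 2)) :
    k * (1 + δ) ^ (2 * powerExponent s + 1) <
      (1 + 3 / 2 * δ) ^ (2 * powerExponent s) * (δ / 2) := by
  have hδ0 : 0 < δ := by rw [hδ]; positivity
  have hδ1 : δ ≤ 1 := by
    rw [hδ, div_le_one (by positivity)]
    have : (0 : ℝ) ≤ s := Nat.cast_nonneg s
    nlinarith [mul_nonneg this this, mul_nonneg this (mul_nonneg this this)]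
  have hs1 := succ_le_two_pow s
  have hm : (2 * s + 1 : ℝ) ≤ 2 ^ (s + 1) := by
    rw [pow_succ]; linarith
  have h1 : (1 + δ) * (1 + δ / 4) ≤ 1 + 3 / 2 * δ := by nlinarith
  -- The exponent is 4/δ, so Bernoulli gives 2. The remaining factor 4s + 10 of twice
  -- `powerExponent` produces 2^(4s+10), enough to beat k and 2/δ.
  have h2 : (2 : ℝ) ≤ (1 + δ / 4) ^ (128 * (s + 1) * (2 * s + 1) ^ 2) := by
    have := one_add_mul_le_pow (by linarith : (-2 : ℝ) ≤ δ / 4) (128 * (s + 1) * (2 * s + 1) ^ 2)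
    refine le_trans (le_of_eq ?_) this
    rw [hδ]; push_cast; field_simp; norm_num
  have h3 : (2 : ℝ) ^ (4 * s + 10) ≤ (1 + δ / 4) ^ (2 * powerExponent s) := by
    rw [show 2 * powerExponent s = 128 * (s + 1) * (2 * s + 1) ^ 2 * (4 * s + 10) by
      unfold powerExponent; ring, pow_mul]
    exact pow_le_pow_left₀ (by norm_num) h2 _
  have h4 : (1 + δ) ^ (2 * powerExponent s) * 2 ^ (4 * s + 10) ≤
      (1 + 3 / 2 * δ) ^ (2 * powerExponent s) := by
    refine le_trans (mul_le_mul_of_nonneg_left h3 (by positivity)) ?_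
    rw [← mul_pow]
    exact pow_le_pow_left₀ (by positivity) h1 _
  have hk' : (k : ℝ) ≤ 2 ^ s := by exact_mod_cast hk
  have h5 : k * (1 + δ) < 2 ^ (4 * s + 10) * (δ / 2) := by
    have e1 : (k : ℝ) * (1 + δ) ≤ 2 ^ (s + 1) := by
      rw [pow_succ]
      exact mul_le_mul hk' (by linarith) (by linarith) (by positivity)
    refine lt_of_le_of_lt e1 ?_
    have e2 : (2 : ℝ) ^ (4 * s + 10) * (δ / 2) =
        2 ^ (4 * s + 4) / ((s + 1) * (2 * s + 1) ^ 2) := by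
      rw [hδ, show 4 * s + 10 = 4 * s + 4 + 6 by ring, pow_add]
      field_simp; norm_num
    rw [e2, lt_div_iff₀ (by positivity)]
    have e3 : ((s : ℝ) + 1) * (2 * s + 1) ^ 2 ≤ 2 ^ s * (2 ^ (s + 1)) ^ 2 :=
      mul_le_mul hs1 (pow_le_pow_left₀ (by positivity) hm 2) (by positivity) (by positivity)
    refine lt_of_le_of_lt (mul_le_mul_of_nonneg_left e3 (by positivity)) ?_
    rw [← pow_mul, ← pow_add, ← pow_add]
    exact pow_lt_pow_right₀ (by norm_num) (by omega)
  calc k * (1 + δ) ^ (2 * powerExponent s + 1)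
      = k * (1 + δ) * (1 + δ) ^ (2 * powerExponent s) := by ring
    _ < 2 ^ (4 * s + 10) * (δ / 2) * (1 + δ) ^ (2 * powerExponent s) :=
        mul_lt_mul_of_pos_right h5 (by positivity)
    _ = (1 + δ) ^ (2 * powerExponent s) * 2 ^ (4 * s + 10) * (δ / 2) := by ring
    _ ≤ _ := mul_le_mul_of_nonneg_right h4 (by positivity)

theorem mul_le_sq_mul_two_pow {s k : ℕ} (hk : k ≤ 2 ^ s) {δ : ℝ}
    (hδ : δ = 1 / (32 * (s + 1) * (2 * s + 1) ^ 2)) :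
    36 * (k : ℝ) ≤ δ ^ 2 * (2 ^ 22 : ℝ) ^ (s + 1) := by
  have hs1 := succ_le_two_pow s
  have hm : (2 * s + 1 : ℝ) ≤ 2 ^ (s + 1) := by
    rw [pow_succ]; linarith
  have hk' : (k : ℝ) ≤ 2 ^ s := by exact_mod_cast hk
  rw [hδ, div_pow, one_pow, div_mul_eq_mul_div, one_mul, le_div_iff₀ (by positivity)]
  have e1 : (32 * ((s : ℝ) + 1) * (2 * s + 1) ^ 2) ^ 2 ≤
      (2 ^ 5 * 2 ^ s * (2 ^ (s + 1)) ^ 2) ^ 2 := by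
    refine pow_le_pow_left₀ (by positivity) ?_ 2
    refine mul_le_mul ?_ (pow_le_pow_left₀ (by positivity) hm 2) (by positivity) (by positivity)
    linarith
  have e2 : 36 * (k : ℝ) ≤ 2 ^ 6 * 2 ^ s := by
    have := Nat.cast_nonneg (α := ℝ) k
    linarith
  refine (mul_le_mul e2 e1 (by positivity) (by positivity)).trans ?_
  rw [← pow_mul, ← pow_add, ← pow_add, ← pow_add, ← pow_mul, ← pow_add, ← pow_mul]
  exact pow_le_pow_right₀ (by norm_num) (by omega)

/-- Averaged against the weight, the quadratic gives at most -1/(4(s+1)), the constant c S only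
helps because the mass is positive, and the approximation error costs at most 1/(8(s+1)). -/
theorem false_of_approximate_factorization {s k b : ℕ} (hs : 1 ≤ s) (hk : k ≤ 2 ^ s)
    (hb : blockSize s ≤ b)
    {U : Finset (Fin (2 * s + 1) × Fin b) → Matrix (Fin k) (Fin k) ℝ}
    {V : (Fin (2 * s + 1) → Fin b) → Matrix (Fin k) (Fin k) ℝ}
    {c : (Fin (2 * s + 1) → Fin b) → ℝ} (hc : ∀ S, 0 ≤ c S)
    (hU : ∀ x, (U x).PosSemidef) (hV : ∀ S, (V S).PosDef)
    (hUV : ∀ S x, |(U x * V S).trace + c S -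
      ((#(x ∩ transversal S) : ℝ) - s) * (#(x ∩ transversal S) - (s + 1))| ≤ 1 / (8 * (s + 1))) :
    False := by
  have hb1 : 1 ≤ b := le_trans (Nat.one_le_iff_ne_zero.2 (by simp [blockSize, powerExponent])) hb
  have hbF : Nonempty (Fin b) := ⟨⟨0, hb1⟩⟩
  have hs0 : (1 : ℝ) ≤ s := by exact_mod_cast hs
  obtain ⟨C, D, hDC, hsum⟩ := exists_normalization hV
  have hMpos : (0 : ℝ) < Fintype.card (Fin (2 * s + 1) → Fin b) := by
    exact_mod_cast Fintype.card_pos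
  have htr : ∀ x S, ((((Fintype.card (Fin (2 * s + 1) → Fin b) : ℝ))⁻¹ •
      (C * U x * C.transpose)) * (D.transpose * V S * D)).trace =
      (Fintype.card (Fin (2 * s + 1) → Fin b) : ℝ)⁻¹ * (U x * V S).trace := fun x S => by
    rw [smul_mul_assoc, Matrix.trace_smul, smul_eq_mul, trace_conj_mul_conj hDC]
  -- With B = (2s+1)², this makes 4Bδ equal to the remaining gap 1/(8(s+1)).
  obtain ⟨δ, hδ⟩ : ∃ δ : ℝ, δ = 1 / (32 * (s + 1) * (2 * s + 1) ^ 2) := ⟨_, rfl⟩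
  have hδ0 : 0 < δ := by rw [hδ]; positivity
  have hδ1 : δ ≤ 1 := by
    rw [hδ, div_le_one (by positivity)]
    nlinarith [mul_nonneg (zero_le_one.trans hs0) (zero_le_one.trans hs0)]
  have hle : ∀ x S, (U x * V S).trace ≤ (2 * s + 1 : ℝ) ^ 2 := fun x S => by
    have h1 := (abs_le.1 (hUV S x)).2
    have h2 := hc S
    have h3 : (1 : ℝ) / (8 * (s + 1)) ≤ 1 := by
      rw [div_le_one (by positivity)]; linarith
    have h4 : (#(x ∩ transversal S) : ℝ) ≤ 2 * s + 1 := by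
      have := card_le_card (inter_subset_right (s₁ := x) (s₂ := transversal S))
      rw [card_transversal] at this
      exact_mod_cast this
    have h5 : (0 : ℝ) ≤ #(x ∩ transversal S) := Nat.cast_nonneg _
    nlinarith [mul_nonneg h5 (sub_nonneg.2 h4)]
  refine false_of_normalized_factorization (n := Fin k) (q := powerExponent s) (Θ := 2 ^ 22)
    (B := (2 * s + 1) ^ 2) (δ := δ) hb1 (U := fun x =>
      (Fintype.card (Fin (2 * s + 1) → Fin b) : ℝ)⁻¹ • (C * U x * C.transpose))
    (V := fun S => D.transpose * V S * D) ?_ ?_ hsum (by positivity) hδ0 hδ1 ?_ ?_ ?_ (by norm_num)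
    ?_ ?_
  · intro x
    have := (hU x).mul_mul_conjTranspose_same C
    rw [Matrix.conjTranspose_eq_transpose_of_trivial] at this
    exact this.smul (by positivity)
  · intro S
    have := (hV S).posSemidef.conjTranspose_mul_mul_same D
    rwa [Matrix.conjTranspose_eq_transpose_of_trivial] at this
  · intro x
    rw [← mul_one ((Fintype.card (Fin (2 * s + 1) → Fin b) : ℝ)⁻¹ • (C * U x * C.transpose)),
      ← hsum, mul_sum, Matrix.trace_sum, sum_congr rfl fun S _ => htr x S, ← mul_sum,
      inv_mul_le_iff₀ hMpos]
    refine (sum_le_sum fun S _ => hle x S).trans_eq ?_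
    rw [sum_const, nsmul_eq_mul, card_univ]
  · intro S
    simp only [htr]
    have e1 : (Fintype.card (Fin (2 * s + 1) → Fin b) : ℝ) *
        ∑ x, knapsackWeight s #(x ∩ transversal S) *
          ((Fintype.card (Fin (2 * s + 1) → Fin b) : ℝ)⁻¹ * (U x * V S).trace) =
        ∑ x, knapsackWeight s #(x ∩ transversal S) * (U x * V S).trace := by
      rw [mul_sum]
      refine sum_congr rfl fun x _ => ?_
      field_simp
    rw [e1]
    have hT : #(transversal S) = 2 * s + 1 := card_transversal S
    set N : ℝ := (Fintype.card (Finset (Fin (2 * s + 1) × Fin b)) : ℝ) with hN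
    have hN2 : N = 2 ^ #(transversal S)ᶜ * 2 ^ (2 * s + 1) := by
      rw [hN, card_finset_eq (transversal S), hT]
    have m1 := sum_inter_eq (transversal S) (fun y => knapsackWeight s #y)
    have m2 := sum_inter_eq (transversal S)
      (fun y => knapsackWeight s #y * (((#y : ℝ) - s) * (#y - (s + 1))))
    rw [sum_powerset_knapsackWeight hT] at m1
    rw [sum_powerset_knapsackWeight_mul_quadratic hs hT] at m2
    have hmass : N / (s + 1) ≤ 2 ^ #(transversal S)ᶜ * knapsackMass s := by
      rw [hN2, mul_div_assoc]
      exact mul_le_mul_of_nonneg_left (two_pow_div_le_knapsackMass s) (by positivity)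
    have hpt : ∀ x, knapsackWeight s #(x ∩ transversal S) * (U x * V S).trace ≤
        knapsackWeight s #(x ∩ transversal S) * (((#(x ∩ transversal S) : ℝ) - s) *
          (#(x ∩ transversal S) - (s + 1))) - c S * knapsackWeight s #(x ∩ transversal S) +
          1 / (8 * (s + 1)) := fun x => by
      have h1 : knapsackWeight s #(x ∩ transversal S) * ((U x * V S).trace + c S -
        ((#(x ∩ transversal S) : ℝ) - s) * (#(x ∩ transversal S) - (s + 1))) ≤
          1 / (8 * (s + 1)) := by
        refine (le_abs_self _).trans ?_
        rw [abs_mul]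
        exact (mul_le_of_le_one_left (abs_nonneg _) (abs_knapsackWeight_le_one s _)).trans
          (hUV S x)
      linarith
    refine (sum_le_sum fun x _ => hpt x).trans ?_
    rw [sum_add_distrib, sum_sub_distrib, ← mul_sum, m1, m2, sum_const, nsmul_eq_mul, card_univ]
    have h6 : 0 ≤ c S * (2 ^ #(transversal S)ᶜ * knapsackMass s) :=
      mul_nonneg (hc S) (mul_nonneg (by positivity) (knapsackMass_pos s).le)
    have h7 : N * (4 * (2 * s + 1) ^ 2 * δ) = N / (s + 1) / 8 := by
      rw [hδ]; field_simp; ring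
    have h8 : N * (1 / (8 * (s + 1))) = N / (s + 1) / 8 := by field_simp
    rw [h7]
    change _ + N * (1 / (8 * (s + 1))) ≤ _
    rw [h8]
    linarith
  · rw [Fintype.card_fin]
    exact powerExponent_spec hk hδ
  · exact_mod_cast hb
  · rw [Fintype.card_fin]
    exact mul_le_sq_mul_two_pow hk hδ

/-! ### Approximate conic duality for psd lifts. -/

section Duality

variable {k : ℕ} {X : Type*} [Fintype X]

theorem trace_mul_vecMulVec {n : Type*} [Fintype n] (A : Matrix n n ℝ) (v : n → ℝ) :
    (A * Matrix.vecMulVec v v).trace = v ⬝ᵥ A.mulVec v := by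
  rw [Matrix.mul_vecMulVec, Matrix.trace_vecMulVec, dotProduct_comm]

/-- Conic duality for spectrahedra, without any constraint qualification: a nonnegative affine
functional agrees approximately with a psd one on finitely many points. -/
theorem exists_posDef_trace_approx [Nonempty X] {L : AffineSubspace ℝ (Matrix (Fin k) (Fin k) ℝ)}
    {Y : X → Matrix (Fin k) (Fin k) ℝ} (hY : ∀ x, (Y x).PosSemidef) (hL : ∀ x, Y x ∈ L)
    (φ : Matrix (Fin k) (Fin k) ℝ →ₗ[ℝ] ℝ) (κ : ℝ)
    (hφ : ∀ Z : Matrix (Fin k) (Fin k) ℝ, Z.PosSemidef → Z ∈ L → 0 ≤ φ Z + κ) {ε : ℝ} (hε : 0 < ε) :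
    ∃ (V : Matrix (Fin k) (Fin k) ℝ) (c : ℝ), V.PosDef ∧ 0 ≤ c ∧
      ∀ x, |(Y x * V).trace + c - (φ (Y x) + κ)| ≤ ε := by
  set K : Set (X → ℝ) := {v | ∃ (V : Matrix (Fin k) (Fin k) ℝ) (c : ℝ), V.PosSemidef ∧ 0 ≤ c ∧
    v = fun x => (Y x * V).trace + c} with hK
  set w : X → ℝ := fun x => φ (Y x) + κ with hw
  have hconv : Convex ℝ K := by
    rintro _ ⟨V, c, hV, hc, rfl⟩ _ ⟨V', c', hV', hc', rfl⟩ a b ha hb _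
    refine ⟨a • V + b • V', a * c + b * c', (hV.smul ha).add (hV'.smul hb), by positivity, ?_⟩
    funext x
    simp only [Pi.add_apply, Pi.smul_apply, smul_eq_mul, mul_add, Matrix.trace_add,
      Matrix.mul_smul, Matrix.trace_smul]
    ring
  have hmem : w ∈ closure K := by
    by_contra hnot
    -- The separating functional has coefficients l x with t = ∑ l x ≥ 0 and W = ∑ l x • Y x psd.
    -- Moving from Y x₀ in direction W and rescaling by 1 + σt stays in L and in the cone.
    obtain ⟨f, u, hfw, hfK⟩ := geometric_hahn_banach_point_closed hconv.closure isClosed_closure hnot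
    have h0 : (0 : X → ℝ) ∈ K := ⟨0, 0, Matrix.PosSemidef.zero, le_rfl, by funext x; simp⟩
    have hu : u < 0 := by simpa using hfK 0 (subset_closure h0)
    have hnn : ∀ (V : Matrix (Fin k) (Fin k) ℝ) (c : ℝ), V.PosSemidef → 0 ≤ c →
        0 ≤ f (fun x => (Y x * V).trace + c) := by
      intro V c hV hc
      by_contra hneg
      push Not at hneg
      set r := f (fun x => (Y x * V).trace + c) with hr
      have hpos : 0 < u / r := div_pos_of_neg_of_neg hu hneg
      have h1 := hfK _ (subset_closure (show (u / r) • (fun x => (Y x * V).trace + c) ∈ K from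
        ⟨(u / r) • V, u / r * c, hV.smul hpos.le, by positivity, by
          funext x; simp [mul_add]⟩))
      rw [map_smul, ← hr, smul_eq_mul, div_mul_cancel₀ _ hneg.ne] at h1
      exact lt_irrefl _ h1
    classical
    set l : X → ℝ := fun x => f (fun y => if x = y then 1 else 0) with hl
    have hf : ∀ v : X → ℝ, f v = ∑ x, v x * l x := fun v =>
      LinearMap.pi_apply_eq_sum_univ (f : (X → ℝ) →ₗ[ℝ] ℝ) v
    set W : Matrix (Fin k) (Fin k) ℝ := ∑ x, l x • Y x with hW
    set t : ℝ := ∑ x, l x with ht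
    have ht0 : 0 ≤ t := by
      have := hnn 0 1 Matrix.PosSemidef.zero zero_le_one
      rw [hf] at this
      simpa using this
    have hWpos : W.PosSemidef := by
      rw [Matrix.posSemidef_iff_dotProduct_mulVec]
      refine ⟨?_, fun v => ?_⟩
      · rw [hW, Matrix.IsHermitian, Matrix.conjTranspose_sum]
        refine sum_congr rfl fun x _ => ?_
        rw [Matrix.conjTranspose_smul, (hY x).1.eq, star_trivial]
      · have h1 := hnn (Matrix.vecMulVec v v) 0 (by
          simpa using Matrix.posSemidef_vecMulVec_self_star v) le_rfl
        rw [hf] at h1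
        refine h1.trans_eq ?_
        rw [star_trivial, hW, Matrix.sum_mulVec, dotProduct_sum]
        refine sum_congr rfl fun x _ => ?_
        rw [add_zero, trace_mul_vecMulVec, Matrix.smul_mulVec, dotProduct_smul, smul_eq_mul, mul_comm]
    obtain ⟨x₀⟩ := ‹Nonempty X›
    set A : ℝ := φ (Y x₀) + κ with hA
    have hA0 : 0 ≤ A := hφ _ (hY x₀) (hL x₀)
    have hb0 : f w < 0 := hfw.trans hu
    -- Chosen so that A + σ f(w) = -1, which makes the functional negative at the rescaled point.
    set σ : ℝ := (A + 1) / (-f w) with hσ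
    have hσ0 : 0 < σ := div_pos (by linarith) (by linarith)
    have hσf : σ * f w = -(A + 1) := by
      rw [hσ]; field_simp [hb0.ne]
    have hden : 0 < 1 + σ * t := by positivity
    have hφW : φ W + t * κ = f w := by
      rw [hf, hW, ht, map_sum, sum_mul, ← sum_add_distrib]
      refine sum_congr rfl fun x _ => ?_
      rw [map_smul, smul_eq_mul]; ring
    have hdir : (1 + σ * t)⁻¹ • σ • ∑ x, l x • (Y x - Y x₀) ∈ L.direction :=
      Submodule.smul_mem _ _ (Submodule.smul_mem _ _ (Submodule.sum_mem _ fun x _ =>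
        Submodule.smul_mem _ _ (L.vsub_mem_direction (hL x) (hL x₀))))
    have hZ : (1 + σ * t)⁻¹ • (Y x₀ + σ • W) =
        (1 + σ * t)⁻¹ • σ • ∑ x, l x • (Y x - Y x₀) + Y x₀ := by
      have h2 : ∑ x, l x • (Y x - Y x₀) = W - t • Y x₀ := by
        simp only [smul_sub, sum_sub_distrib, ← sum_smul, hW, ht]
      have h3 : Y x₀ = (1 + σ * t)⁻¹ • (1 + σ * t) • Y x₀ := by
        rw [smul_smul, inv_mul_cancel₀ hden.ne', one_smul]
      rw [h2]
      conv_rhs => rw [h3]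
      rw [← smul_add]
      congr 1
      rw [← h3]
      module
    have h4 := hφ ((1 + σ * t)⁻¹ • (Y x₀ + σ • W))
      (((hY x₀).add (hWpos.smul hσ0.le)).smul (by positivity)) (by
        rw [hZ]
        exact AffineSubspace.vadd_mem_of_mem_direction hdir (hL x₀))
    have h5 : φ ((1 + σ * t)⁻¹ • (Y x₀ + σ • W)) + κ = (1 + σ * t)⁻¹ * (A + σ * f w) := by
      rw [map_smul, map_add, map_smul, ← hφW, hA]
      simp only [smul_eq_mul]
      field_simp
      ring
    rw [h5, hσf] at h4
    have : (1 + σ * t)⁻¹ * (A + -(A + 1)) < 0 := by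
      have := inv_pos.2 hden
      nlinarith
    linarith
  obtain ⟨_, ⟨V, c, hV, hc, rfl⟩, hdist⟩ := Metric.mem_closure_iff.1 hmem (ε / 2) (half_pos hε)
  set τ : ℝ := ∑ x, (Y x).trace with hτ
  have hτ0 : 0 ≤ τ := sum_nonneg fun x _ => (hY x).trace_nonneg
  -- Adding η • 1 makes V definite and changes every trace by at most ε/2.
  set η : ℝ := ε / 2 / (τ + 1) with hη
  have hη0 : 0 < η := by positivity
  refine ⟨V + η • 1, c, Matrix.PosDef.posSemidef_add hV (Matrix.PosDef.one.smul hη0), hc, fun x => ?_⟩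
  have h1 : |w x - ((Y x * V).trace + c)| ≤ ε / 2 :=
    (dist_le_pi_dist w (fun x => (Y x * V).trace + c) x).trans hdist.le
  have h2 : η * (Y x).trace ≤ ε / 2 := by
    have h3 : (Y x).trace ≤ τ :=
      single_le_sum (f := fun x => (Y x).trace) (fun x _ => (hY x).trace_nonneg) (mem_univ x)
    have h4 : η * (τ + 1) = ε / 2 := by rw [hη]; field_simp
    nlinarith
  have h3 : 0 ≤ η * (Y x).trace := mul_nonneg hη0.le (hY x).trace_nonneg
  rw [mul_add, Matrix.trace_add, Matrix.mul_smul, mul_one, Matrix.trace_smul, smul_eq_mul]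
  rw [abs_le] at h1 ⊢
  simp only [hw] at h1
  constructor <;> linarith

end Duality

/-! ### From lifts of the correlation polytope to factorizations. -/

section Correlation

variable {n : ℕ}

theorem vecMulVec_mem_corrPolytope {x : Fin n → ℝ} (hx : ∀ i, x i = 0 ∨ x i = 1) :
    Matrix.vecMulVec x x ∈ corrPolytope n :=
  subset_convexHull ℝ _ ⟨x, hx, rfl⟩

theorem nonneg_of_mem_corrPolytope {φ : Matrix (Fin n) (Fin n) ℝ →ₗ[ℝ] ℝ} {κ : ℝ}
    (h : ∀ x : Fin n → ℝ, (∀ i, x i = 0 ∨ x i = 1) → 0 ≤ φ (Matrix.vecMulVec x x) + κ)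
    {M : Matrix (Fin n) (Fin n) ℝ} (hM : M ∈ corrPolytope n) : 0 ≤ φ M + κ := by
  have hconv : Convex ℝ {M | -κ ≤ φ M} := convex_halfSpace_ge φ.isLinear (-κ)
  have := convexHull_min (s := {M | ∃ x : Fin n → ℝ, (∀ i, x i = 0 ∨ x i = 1) ∧
    M = Matrix.vecMulVec x x}) (by
      rintro _ ⟨x, hx, rfl⟩
      have := h x hx
      simp only [Set.mem_ofPred_eq]; linarith) hconv hM
  simp only [Set.mem_ofPred_eq] at this
  linarith

theorem exists_lift_point {k : ℕ} {L : AffineSubspace ℝ (Matrix (Fin k) (Fin k) ℝ)}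
    {π : Matrix (Fin k) (Fin k) ℝ →ₗ[ℝ] Matrix (Fin n) (Fin n) ℝ}
    (h : corrPolytope n = π '' ({Y | Y.PosSemidef} ∩ (L : Set (Matrix (Fin k) (Fin k) ℝ))))
    {x : Fin n → ℝ} (hx : ∀ i, x i = 0 ∨ x i = 1) :
    ∃ Y : Matrix (Fin k) (Fin k) ℝ, Y.PosSemidef ∧ Y ∈ L ∧ π Y = Matrix.vecMulVec x x := by
  have := vecMulVec_mem_corrPolytope hx
  rw [h] at this
  obtain ⟨Y, ⟨h1, h2⟩, h3⟩ := this
  exact ⟨Y, h1, h2, h3⟩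

/-- The quadratic `(z - s) * (z - (s + 1))`, `z` the sum of the coordinates in `T`, as a linear
functional of `x xᵀ` up to a constant. -/
noncomputable def knapsackFunctional (s : ℕ) (T : Finset (Fin n)) :
    Matrix (Fin n) (Fin n) ℝ →ₗ[ℝ] ℝ :=
  ∑ i ∈ T, ∑ j ∈ T, Matrix.entryLinearMap ℝ ℝ i j -
    (2 * s + 1 : ℝ) • ∑ i ∈ T, Matrix.entryLinearMap ℝ ℝ i i

theorem knapsackFunctional_indicator (s : ℕ) (T x : Finset (Fin n)) :
    knapsackFunctional s T (Matrix.vecMulVec (fun i => if i ∈ x then 1 else 0)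
      (fun i => if i ∈ x then 1 else 0)) + s * (s + 1) =
      ((#(x ∩ T) : ℝ) - s) * (#(x ∩ T) - (s + 1)) := by
  have h : (∑ i ∈ T, if i ∈ x then (1 : ℝ) else 0) = #(x ∩ T) := by
    rw [← sum_filter, sum_const, nsmul_eq_mul, mul_one, filter_mem_eq_inter, inter_comm]
  have h2 : ∀ i, (if i ∈ x then (1 : ℝ) else 0) * (if i ∈ x then 1 else 0) =
      if i ∈ x then 1 else 0 := fun i => by split_ifs <;> simp
  simp only [knapsackFunctional, LinearMap.sub_apply, LinearMap.smul_apply, LinearMap.sum_apply,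
    Matrix.entryLinearMap_apply, Matrix.vecMulVec_apply, h2, smul_eq_mul]
  rw [← sum_mul_sum, h]
  ring

theorem eq_indicator {x : Fin n → ℝ} (hx : ∀ i, x i = 0 ∨ x i = 1) :
    x = fun i => if i ∈ ({i | x i = 1} : Finset (Fin n)) then 1 else 0 := by
  funext i
  rcases hx i with h | h <;> simp [h]

theorem sub_mul_sub_succ_nonneg (s w : ℕ) : (0 : ℝ) ≤ ((w : ℝ) - s) * (w - (s + 1)) := by
  rcases Nat.lt_or_ge s w with h | h
  · have : (s + 1 : ℝ) ≤ w := by exact_mod_cast h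
    exact mul_nonneg (by linarith) (by linarith)
  · have : (w : ℝ) ≤ s := by exact_mod_cast h
    exact mul_nonneg_of_nonpos_of_nonpos (by linarith) (by linarith)

theorem not_hasPsdLift_corrPolytope {s k : ℕ} (hs : 1 ≤ s) (hk : k ≤ 2 ^ s)
    (hn : (2 * s + 1) * blockSize s ≤ n) : ¬ HasPsdLift (corrPolytope n) k := by
  rintro ⟨L, π, hlift⟩
  obtain ⟨e⟩ : Nonempty (Fin (2 * s + 1) × Fin (blockSize s) ↪ Fin n) :=
    Function.Embedding.nonempty_of_card_le (by simpa using hn)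
  have hvert : ∀ x : Finset (Fin n), ∀ i, (if i ∈ x then (1 : ℝ) else 0) = 0 ∨
      (if i ∈ x then (1 : ℝ) else 0) = 1 := fun x i => by split_ifs <;> simp
  choose Y hYpos hYL hYπ using fun x : Finset (Fin (2 * s + 1) × Fin (blockSize s)) =>
    exists_lift_point hlift (hvert (x.map e))
  have hfac : ∀ S : Fin (2 * s + 1) → Fin (blockSize s),
      ∃ (V : Matrix (Fin k) (Fin k) ℝ) (c : ℝ), V.PosDef ∧ 0 ≤ c ∧ ∀ x,
        |(Y x * V).trace + c - (((knapsackFunctional s ((transversal S).map e)).comp π) (Y x) +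
          s * (s + 1))| ≤ 1 / (8 * (s + 1)) := fun S => by
    refine exists_posDef_trace_approx hYpos hYL _ _ (fun Z hZ hZL => ?_) (by positivity)
    refine nonneg_of_mem_corrPolytope (φ := knapsackFunctional s ((transversal S).map e))
      (fun x hx => ?_) (M := π Z) (by rw [hlift]; exact ⟨Z, ⟨hZ, hZL⟩, rfl⟩)
    rw [eq_indicator hx, knapsackFunctional_indicator]
    exact sub_mul_sub_succ_nonneg _ _
  choose V c hV hc hVc using hfac
  refine false_of_approximate_factorization hs hk le_rfl hc hYpos hV fun S x => ?_
  have h := hVc S x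
  rwa [LinearMap.comp_apply, hYπ, knapsackFunctional_indicator, ← map_inter, card_map] at h

/-- In size at most 1 every matrix or its negative is psd. So the segment between lifts of two
vertices extends within the spectrahedron past one end, pushing a diagonal entry to 2 or to -1. -/
theorem not_hasPsdLift_corrPolytope_of_le_one {k : ℕ} (hn : 1 ≤ n) (hk : k ≤ 1) :
    ¬ HasPsdLift (corrPolytope n) k := by
  rintro ⟨L, π, hlift⟩
  obtain ⟨Y₀, h0, h0L, h0π⟩ := exists_lift_point hlift (x := fun _ => 0) (by simp)
  obtain ⟨Y₁, h1, h1L, h1π⟩ := exists_lift_point hlift (x := fun _ => 1) (by simp)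
  have hsub : Subsingleton (Fin k) := by rw [Fin.subsingleton_iff_le_one]; exact hk
  set i : Fin n := ⟨0, hn⟩
  have hge : ∀ M ∈ corrPolytope n, 0 ≤ M i i := fun M hM => by
    have := nonneg_of_mem_corrPolytope (φ := Matrix.entryLinearMap ℝ ℝ i i) (κ := 0)
      (fun x hx => by rcases hx i with h | h <;> simp [Matrix.vecMulVec_apply, h]) hM
    simpa using this
  have hle : ∀ M ∈ corrPolytope n, M i i ≤ 1 := fun M hM => by
    have := nonneg_of_mem_corrPolytope (φ := -Matrix.entryLinearMap ℝ ℝ i i) (κ := 1)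
      (fun x hx => by rcases hx i with h | h <;> simp [Matrix.vecMulVec_apply, h]) hM
    simpa using this
  have hp0 : π Y₀ i i = 0 := by rw [h0π]; simp [Matrix.vecMulVec_apply]
  have hp1 : π Y₁ i i = 1 := by rw [h1π]; simp [Matrix.vecMulVec_apply]
  have hdiag : ∀ d : Fin k → ℝ, (Matrix.diagonal d).PosSemidef ∨
      (Matrix.diagonal (-d)).PosSemidef := fun d => by
    rw [Matrix.posSemidef_diagonal_iff, Matrix.posSemidef_diagonal_iff]
    rcases isEmpty_or_nonempty (Fin k) with h | ⟨⟨j⟩⟩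
    · exact Or.inl fun j => h.elim j
    · rcases le_total 0 (d j) with h | h
      · exact Or.inl fun a => by rwa [Subsingleton.elim a j]
      · exact Or.inr fun a => by
          rw [Subsingleton.elim a j]; simpa using h
  have hpsd : ∀ A : Matrix (Fin k) (Fin k) ℝ, A.PosSemidef ∨ (-A).PosSemidef := fun A => by
    have h1 : A = Matrix.diagonal fun j => A j j := by
      ext a b; rw [Subsingleton.elim b a]; simp
    have h2 : -A = Matrix.diagonal (-fun j => A j j) := by
      ext a b; rw [Subsingleton.elim b a]; simp
    rw [h2]
    rw [h1]
    simpa using hdiag fun j => A j j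
  have hd := L.vsub_mem_direction h1L h0L
  rw [vsub_eq_sub] at hd
  rcases hpsd (Y₁ - Y₀) with h | h
  · have hm : π (Y₁ - Y₀ + Y₁) ∈ corrPolytope n := by
      rw [hlift]
      exact ⟨_, ⟨h.add h1, AffineSubspace.vadd_mem_of_mem_direction hd h1L⟩, rfl⟩
    have := hle _ hm
    rw [map_add, map_sub, Matrix.add_apply, Matrix.sub_apply, hp0, hp1] at this
    norm_num at this
  · have hm : π (-(Y₁ - Y₀) + Y₀) ∈ corrPolytope n := by
      rw [hlift]
      exact ⟨_, ⟨h.add h0, AffineSubspace.vadd_mem_of_mem_direction (L.direction.neg_mem hd) h0L⟩, rfl⟩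
    have := hge _ hm
    rw [map_add, map_neg, map_sub, Matrix.add_apply, Matrix.neg_apply, Matrix.sub_apply, hp0, hp1]
      at this
    norm_num at this

end Correlation

/-! ### A lift exists, so the psd rank is a genuine minimum. -/

section Existence

theorem convex_posSemidef (k : ℕ) : Convex ℝ {Y : Matrix (Fin k) (Fin k) ℝ | Y.PosSemidef} :=
  fun _ hA _ hB _ _ ha hb _ => (hA.smul ha).add (hB.smul hb)

/-- The diagonal of a psd matrix of trace 1 is a point of the simplex, so its entries serve as
convex weights on the v i. -/
theorem hasPsdLift_convexHull_range {E : Type*} [AddCommGroup E] [Module ℝ E] {k : ℕ} (hk : 0 < k)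
    (v : Fin k → E) : HasPsdLift (convexHull ℝ (Set.range v)) k := by
  have htr : ∀ i : Fin k, (Matrix.single i i (1 : ℝ)).trace = 1 := fun i => by simp
  have hmem : ∀ Y : Matrix (Fin k) (Fin k) ℝ,
      Y ∈ AffineSubspace.mk' (Matrix.single (⟨0, hk⟩ : Fin k) ⟨0, hk⟩ (1 : ℝ))
        (LinearMap.ker (Matrix.traceLinearMap (Fin k) ℝ ℝ)) ↔ Y.trace = 1 := fun Y => by
    rw [AffineSubspace.mem_mk', LinearMap.mem_ker, vsub_eq_sub, Matrix.traceLinearMap_apply,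
      Matrix.trace_sub, htr, sub_eq_zero]
  refine ⟨AffineSubspace.mk' (Matrix.single (⟨0, hk⟩ : Fin k) ⟨0, hk⟩ (1 : ℝ))
    (LinearMap.ker (Matrix.traceLinearMap (Fin k) ℝ ℝ)),
    ∑ i, (Matrix.entryLinearMap ℝ ℝ i i).smulRight (v i), Set.Subset.antisymm ?_ ?_⟩
  · refine convexHull_min ?_ (((convex_posSemidef k).inter (AffineSubspace.convex _)).linear_image _)
    rintro _ ⟨i, rfl⟩
    refine ⟨Matrix.single i i 1, ⟨?_, (hmem _).2 (htr i)⟩, ?_⟩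
    · show (Matrix.single i i (1 : ℝ)).PosSemidef
      rw [← Matrix.diagonal_single, Matrix.posSemidef_diagonal_iff]
      intro j
      by_cases h : j = i
      · subst h; simp
      · simp [h]
    · simp [LinearMap.sum_apply, Matrix.single_apply]
  · rintro _ ⟨Y, ⟨hY, hYL⟩, rfl⟩
    have h1 := (hmem Y).1 hYL
    simp only [LinearMap.sum_apply, LinearMap.smulRight_apply, Matrix.entryLinearMap_apply]
    exact (convex_convexHull ℝ _).sum_mem (fun i _ => Matrix.PosSemidef.diag_nonneg hY) h1
      fun i _ => subset_convexHull ℝ _ ⟨i, rfl⟩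

theorem hasPsdLift_corrPolytope (n : ℕ) : HasPsdLift (corrPolytope n) (2 ^ n) := by
  let e : Finset (Fin n) ≃ Fin (2 ^ n) := Fintype.equivFinOfCardEq (by simp)
  have h : corrPolytope n = convexHull ℝ (Set.range fun j : Fin (2 ^ n) =>
      Matrix.vecMulVec (fun i => if i ∈ e.symm j then (1 : ℝ) else 0)
        (fun i => if i ∈ e.symm j then (1 : ℝ) else 0)) := by
    rw [corrPolytope]
    congr 1
    ext M
    constructor
    · rintro ⟨x, hx, rfl⟩
      refine ⟨e {i | x i = 1}, ?_⟩
      conv_rhs => rw [eq_indicator hx]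
      simp only [Equiv.symm_apply_apply]
    · rintro ⟨j, rfl⟩
      exact ⟨_, fun i => by split_ifs <;> simp, rfl⟩
  rw [h]
  exact hasPsdLift_convexHull_range (by positivity) _

end Existence

/-! ### Choosing s in terms of n. -/

theorem mul_blockSize_le (s : ℕ) : (2 * s + 1) * blockSize s ≤ (64 * (s + 1)) ^ 6 := by
  have h1 : (2 * s + 1) ^ 4 ≤ (2 * (s + 1)) ^ 4 := Nat.pow_le_pow_left (by omega) 4
  calc (2 * s + 1) * blockSize s = 2 ^ 28 * (s + 1) * ((2 * s + 1) ^ 4 * (4 * s + 10)) := by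
        unfold blockSize powerExponent; ring
    _ ≤ 2 ^ 28 * (s + 1) * ((2 * (s + 1)) ^ 4 * (16 * (s + 1))) :=
        Nat.mul_le_mul_left _ (Nat.mul_le_mul h1 (by omega))
    _ = (64 * (s + 1)) ^ 6 := by ring

theorem not_hasPsdLift_of_lt_two_rpow {n k : ℕ} (hn : 1 ≤ n)
    (hk : (k : ℝ) < 2 ^ ((1 / 256 : ℝ) * (n : ℝ) ^ ((2 : ℝ) / 13))) :
    ¬ HasPsdLift (corrPolytope n) k := by
  have hn1 : (1 : ℝ) ≤ n := by exact_mod_cast hn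
  set y : ℝ := (n : ℝ) ^ ((1 : ℝ) / 6) / 64 with hy
  have hy0 : 0 ≤ y := by positivity
  have hexp : (1 / 256 : ℝ) * (n : ℝ) ^ ((2 : ℝ) / 13) ≤ y / 4 := by
    have := Real.rpow_le_rpow_of_exponent_le hn1 (by norm_num : (2 : ℝ) / 13 ≤ 1 / 6)
    rw [hy]; linarith
  have hk2 : (k : ℝ) < 2 ^ (y / 4) :=
    hk.trans_le (Real.rpow_le_rpow_of_exponent_le one_le_two hexp)
  -- Below 2 the bound only concerns k ≤ 1. Otherwise s = ⌊y⌋ - 1 ≥ 1 satisfies y/4 < (s + 2)/4 ≤ s,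
  -- which is why the constant is 1/256 = (1/64)(1/4).
  rcases lt_or_ge y 2 with h | h
  · refine not_hasPsdLift_corrPolytope_of_le_one hn ?_
    have h1 : (k : ℝ) < 2 ^ (1 : ℝ) :=
      hk2.trans_le (Real.rpow_le_rpow_of_exponent_le one_le_two (by linarith))
    rw [Real.rpow_one] at h1
    have : k < 2 := by exact_mod_cast h1
    omega
  · obtain ⟨s, hs⟩ : ∃ s, ⌊y⌋₊ = s + 1 :=
      Nat.exists_eq_succ_of_ne_zero (Nat.floor_pos.2 (by linarith)).ne'
    have hs1 : 1 ≤ s := by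
      have : 2 ≤ ⌊y⌋₊ := Nat.le_floor (by exact_mod_cast h)
      omega
    have hlo : (s + 1 : ℝ) ≤ y := by
      have := Nat.floor_le hy0
      rw [hs] at this; exact_mod_cast this
    have hhi : y < s + 2 := by
      have := Nat.lt_floor_add_one y
      rw [hs] at this; push_cast at this; linarith
    have hs1' : (1 : ℝ) ≤ s := by exact_mod_cast hs1
    refine not_hasPsdLift_corrPolytope hs1 ?_ ((mul_blockSize_le s).trans ?_)
    · have h1 : (k : ℝ) < 2 ^ (s : ℝ) :=
        hk2.trans_le (Real.rpow_le_rpow_of_exponent_le one_le_two (by linarith))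
      rw [Real.rpow_natCast] at h1
      have : k < 2 ^ s := by exact_mod_cast h1
      exact this.le
    · have h1 : (64 * (s + 1) : ℝ) ≤ (n : ℝ) ^ ((1 : ℝ) / 6) := by rw [hy] at hlo; linarith
      have h2 : (64 * (s + 1) : ℝ) ^ 6 ≤ n := by
        refine (pow_le_pow_left₀ (by positivity) h1 6).trans_eq ?_
        rw [← Real.rpow_natCast, ← Real.rpow_mul (by positivity)]
        norm_num
      exact_mod_cast h2

theorem mainTheorem1 :
    ∃ α : ℝ, 0 < α ∧ ∀ n : ℕ, 1 ≤ n →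
      (2 : ℝ) ^ (α * (n : ℝ) ^ ((2 : ℝ) / 13)) ≤ (psdRank (corrPolytope n) : ℝ) ∧
      ∀ k : ℕ, (k : ℝ) < (2 : ℝ) ^ (α * (n : ℝ) ^ ((2 : ℝ) / 13)) →
        ¬ HasPsdLift (corrPolytope n) k := by
  refine ⟨1 / 256, by norm_num, fun n hn => ⟨?_, fun k hk => not_hasPsdLift_of_lt_two_rpow hn hk⟩⟩
  by_contra hlt
  -- The infimum is attained only because some lift exists; for an empty set of sizes it would be 0.
  exact not_hasPsdLift_of_lt_two_rpow hn (not_le.1 hlt)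
    (Nat.sInf_mem (s := {k | HasPsdLift (corrPolytope n) k}) ⟨_, hasPsdLift_corrPolytope n⟩)
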